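/- Let $\epsilon\in\mathbb{R}$, $\epsilon\neq 0$. There exists $\delta>0$, depending only on $\epsilon$, such that the following holds. Let $u\in C(\mathbb{R};H^1(\mathbb{R};\mathbb{C}))$ be a global solution of $$iu_t+u_{xx}=|u|^2u+\epsilon|u|^4u,\qquad (t,x)\in\mathbb{R}\times\mathbb{R},$$ where the equation holds at every time $t$ in the sense of distributions in $x$, that is, for all $t\in\mathbb{R}$ and $\varphi\in C_c^\infty(\mathbb{R};\mathbb{C})$ the function $s\mapsto\int_{\mathbb{R}}u(s,x)\varphi(x)\,dx$ is differentiable at $t$ and $$i\,\frac{d}{dt}\int_{\mathbb{R}}u(t)\varphi\,dx-\int_{\mathbb{R}}u_x(t)\varphi_x\,dx=\int_{\mathbb{R}}\left(|u(t)|^2u(t)+\epsilon|u(t)|^4u(t)\right)\varphi\,dx.$$ Suppose that $u(t)$ is an odd function of $x$ for every $t\in\mathbb{R}$, and that $\|u(0)\|_{H^1(\mathbb{R})}\le\delta$. Then for every bounded interval $I\subset\mathbb{R}$, $$\lim_{t\to\infty}\left(\|u(t)\|_{L^2(I)}+\|u(t)\|_{L^\infty(I)}\right)=0.$$ -/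

import Mathlib

open MeasureTheory Filter Topology
open scoped ContDiff ENNReal

noncomputable section

namespace QuinticNLS

/-- Test functions on the line: smooth, compactly supported, complex valued. -/
def IsTest (φ : ℝ → ℂ) : Prop :=
  ContDiff ℝ ∞ φ ∧ HasCompactSupport φ

/-- The space `L²(ℝ; ℂ)`. -/
abbrev L2 : Type := Lp ℂ 2 (volume : Measure ℝ)

/-- `g` is the weak derivative of `f`, for `f, g ∈ L²(ℝ; ℂ)`. -/
def IsWeakDeriv (f g : L2) : Prop :=
  ∀ φ : ℝ → ℂ, IsTest φ → ∫ x, f x * deriv φ x = - ∫ x, g x * φ x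

lemma integrable_mul_test (f : L2) {ψ : ℝ → ℂ} (hc : Continuous ψ) (hs : HasCompactSupport ψ) :
    Integrable (fun x => f x * ψ x) :=
  MemLp.integrable_mul (p := 2) (q := 2) (Lp.memLp f) (hc.memLp_of_hasCompactSupport hs)

lemma IsTest.deriv_continuous {φ : ℝ → ℂ} (h : IsTest φ) : Continuous (deriv φ) :=
  h.1.continuous_deriv (by simp)

/-- The Sobolev space `H¹(ℝ; ℂ)`: the pairs `(f, f')` in `L² × L²` whose second entry is the weak
derivative of the first one. With the norm inherited from the `ℓ²`-product,
`‖u‖² = ‖f‖²_{L²} + ‖f'‖²_{L²}`. -/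
def H1 : Submodule ℂ (WithLp 2 (L2 × L2)) where
  carrier := {p | IsWeakDeriv p.fst p.snd}
  zero_mem' := by
    intro φ _
    have h1 : ∫ x, ((0 : L2) x) * deriv φ x = 0 := by
      refine integral_eq_zero_of_ae ?_
      filter_upwards [Lp.coeFn_zero ℂ 2 (volume : Measure ℝ)] with x hx
      rw [hx, Pi.zero_apply, zero_mul]
    have h2 : ∫ x, ((0 : L2) x) * φ x = 0 := by
      refine integral_eq_zero_of_ae ?_
      filter_upwards [Lp.coeFn_zero ℂ 2 (volume : Measure ℝ)] with x hx
      rw [hx, Pi.zero_apply, zero_mul]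
    simp only [WithLp.zero_fst, WithLp.zero_snd]
    rw [h1, h2, neg_zero]
  add_mem' := by
    intro p q hp hq φ hφ
    have key : ∀ (f g : L2) (ψ : ℝ → ℂ), Continuous ψ → HasCompactSupport ψ →
        ∫ x, ((f + g : L2) x) * ψ x = (∫ x, f x * ψ x) + ∫ x, g x * ψ x := by
      intro f g ψ hc hs
      rw [← integral_add (integrable_mul_test f hc hs) (integrable_mul_test g hc hs)]
      refine integral_congr_ae ?_
      filter_upwards [Lp.coeFn_add f g] with x hx
      rw [hx, Pi.add_apply, add_mul]
    have e1 := key p.fst q.fst (deriv φ) hφ.deriv_continuous hφ.2.deriv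
    have e2 := key p.snd q.snd φ hφ.1.continuous hφ.2
    simp only [WithLp.add_fst, WithLp.add_snd]
    rw [e1, e2, hp φ hφ, hq φ hφ]
    ring
  smul_mem' := by
    intro c p hp φ hφ
    have key : ∀ (f : L2) (ψ : ℝ → ℂ),
        ∫ x, ((c • f : L2) x) * ψ x = c * ∫ x, f x * ψ x := by
      intro f ψ
      rw [← integral_const_mul]
      refine integral_congr_ae ?_
      filter_upwards [Lp.coeFn_smul c f] with x hx
      rw [hx, Pi.smul_apply, smul_eq_mul, mul_assoc]
    simp only [WithLp.smul_fst, WithLp.smul_snd]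
    rw [key, key, hp φ hφ]
    ring

/-- The function (class) underlying an element of `H¹`. -/
def fn (f : H1) : L2 := (f : WithLp 2 (L2 × L2)).fst

/-- The weak derivative of an element of `H¹`. -/
def weakDx (f : H1) : L2 := (f : WithLp 2 (L2 × L2)).snd

/-- Odd elements of `H¹`, as classes of functions up to null sets. -/
def IsOddH1 (f : H1) : Prop := ∀ᵐ x : ℝ, fn f (-x) = - fn f x

/-- The nonlinearity `|z|² z + ε |z|⁴ z`. -/
def nonlin (ε : ℝ) (z : ℂ) : ℂ :=
  (‖z‖ : ℂ) ^ 2 * z + (ε : ℂ) * (‖z‖ : ℂ) ^ 4 * z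

/-- `u ∈ C(ℝ; H¹(ℝ))` is a global solution of `i u_t + u_xx = |u|² u + ε |u|⁴ u`. At every time the
equation holds in the sense of distributions in `x`: for each test function `φ`,
`i (d/dt) ∫ u φ dx - ∫ u_x φ_x dx = ∫ (|u|² u + ε |u|⁴ u) φ dx`. -/
def IsGlobalSolution (ε : ℝ) (u : ℝ → H1) : Prop :=
  Continuous u ∧
  ∀ φ : ℝ → ℂ, IsTest φ → ∀ t : ℝ, ∃ d : ℂ,
    HasDerivAt (fun s => ∫ x, fn (u s) x * φ x) d t ∧
    Complex.I * d - ∫ x, weakDx (u t) x * deriv φ x = ∫ x, nonlin ε (fn (u t) x) * φ x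

end QuinticNLS

end

/-!
Local decay of small odd solutions by a virial argument.

Write `y = 1 + |x|`. For `P = Im ∫ ū φ u_x` with `φ = x / y` one has
`P' = 2 ∫ φ' |u_x|² + Re ∫ φ'' ū_x u + (nonlinear part)` (`hasDerivAt_virial`).
* The nonlinear part equals `∫ φ' (|u|⁴ / 2 + 2 ε |u|⁶ / 3)`, so it is nonnegative as soon as
  `|ε| |u|²` is small, whatever the sign of `ε` (`virial_nonlin_nonneg`).
* The quadratic part is bounded below by `m = ∫ y⁻⁴ |u|²` because an odd function vanishes at `0`
  (`virial_coercive`).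
Conservation of mass and energy keeps a small solution small in `H¹` for all times
(`norm_solution_sq_le`), so `P` is bounded, and `P' ≥ m ≥ 0`. The localized mass `m` is Lipschitz in
time (`hasDerivAt_localMass`), hence `m → 0` (`tendsto_zero_of_le_deriv`). Finally
`y⁻² |u|² ≤ 4 √m ‖u‖_{H¹}` turns this into uniform decay on bounded intervals
(`decay_mul_norm_rep_sq_le`).

The solution is only continuous in time with values in `H¹`, so none of these identities can be
obtained by differentiating directly. They are proved for the time averages
`U(t) = ∫₀¹ u(t + h s) ds`. These are differentiable in time with values in `H¹`, and the equation
`i U_t + U_xx = G`, with `G` the average of the nonlinearity, then gives `U_xx ∈ L²`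
(`exists_avg_equation`). Each resulting identity is a continuous expression in `(U, G) ∈ H¹ × H¹`,
and it passes to the limit `h → 0` (`hasDerivAt_of_avg`). That the nonlinearity maps `H¹`
continuously into itself comes from the algebra structure of `H¹` (`mulL`), which in turn rests on
continuous representatives that are locally absolutely continuous (`exists_rep`).
-/

noncomputable section

namespace QuinticNLS

/-! ### Primitives of locally integrable functions -/

/-- `F` is a primitive of the locally integrable function `f`; equivalently, `F` is locally
absolutely continuous with derivative `f`. -/
structure IsPrimitive (F f : ℝ → ℂ) : Prop where
  locInt : LocallyIntegrable f
  eq_integral : ∀ a b, F b - F a = ∫ x in a..b, f x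

namespace IsPrimitive

variable {F f G g : ℝ → ℂ}

lemma intervalIntegrable (h : IsPrimitive F f) (a b : ℝ) : IntervalIntegrable f volume a b :=
  (h.locInt.integrableOn_isCompact isCompact_uIcc).intervalIntegrable

lemma eq_add (h : IsPrimitive F f) (a : ℝ) : F = fun x => F a + ∫ t in a..x, f t := by
  ext x
  rw [← h.eq_integral a x]; ring

lemma continuous (h : IsPrimitive F f) : Continuous F := by
  rw [h.eq_add 0]
  exact continuous_const.add (intervalIntegral.continuous_primitive h.intervalIntegrable 0)

lemma ae_hasDerivAt (h : IsPrimitive F f) : ∀ᵐ x, HasDerivAt F (f x) x := by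
  filter_upwards [LocallyIntegrable.ae_hasDerivAt_integral h.locInt] with x hx
  rw [h.eq_add 0]
  exact (hx 0).const_add _

lemma absolutelyContinuous (h : IsPrimitive F f) (a b : ℝ) :
    AbsolutelyContinuousOnInterval F a b := by
  have h1 := (h.intervalIntegrable a b).norm.absolutelyContinuousOnInterval_intervalIntegral
    (c := a) (by simp)
  refine squeeze_zero (fun t ↦ Finset.sum_nonneg (fun i hi ↦ dist_nonneg)) (fun t ↦ ?_) h1
  refine Finset.sum_le_sum fun i _ ↦ ?_
  rw [dist_comm, dist_eq_norm, h.eq_integral, dist_comm, Real.dist_eq,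
    intervalIntegral.integral_interval_sub_left ((h.intervalIntegrable _ _).norm)
      ((h.intervalIntegrable _ _).norm)]
  exact intervalIntegral.norm_integral_le_abs_integral_norm

lemma congr_ae (h : IsPrimitive F f) (hfg : f =ᵐ[volume] g) : IsPrimitive F g where
  locInt := h.locInt.congr hfg
  eq_integral a b := by
    rw [h.eq_integral a b]
    exact intervalIntegral.integral_congr_ae (hfg.mono fun x hx _ => hx)

lemma of_hasDerivAt (h : ∀ x, HasDerivAt F (f x) x) (hf : Continuous f) : IsPrimitive F f where
  locInt := hf.locallyIntegrable
  eq_integral a b :=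
    (intervalIntegral.integral_eq_sub_of_hasDerivAt (fun x _ => h x)
      (hf.intervalIntegrable a b)).symm

lemma const (c : ℂ) : IsPrimitive (fun _ => c) (fun _ => 0) :=
  of_hasDerivAt (fun x => hasDerivAt_const x c) continuous_const

lemma add (hF : IsPrimitive F f) (hG : IsPrimitive G g) :
    IsPrimitive (fun x => F x + G x) (fun x => f x + g x) where
  locInt := hF.locInt.add hG.locInt
  eq_integral a b := by
    rw [intervalIntegral.integral_add (hF.intervalIntegrable a b) (hG.intervalIntegrable a b),
      ← hF.eq_integral, ← hG.eq_integral]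
    ring

lemma conj (hF : IsPrimitive F f) :
    IsPrimitive (fun x => starRingEnd ℂ (F x)) (fun x => starRingEnd ℂ (f x)) where
  locInt := by
    intro x
    obtain ⟨s, hs, h⟩ := hF.locInt x
    exact ⟨s, hs, (LinearIsometryEquiv.integrable_comp_iff Complex.conjLIE).2 h⟩
  eq_integral a b := by
    rw [← map_sub, hF.eq_integral a b]
    simp only [intervalIntegral, map_sub, integral_conj]

/-- The product rule for locally absolutely continuous functions. -/
lemma mul (hF : IsPrimitive F f) (hG : IsPrimitive G g) :
    IsPrimitive (fun x => F x * G x) (fun x => f x * G x + F x * g x) := by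
  have hloc : LocallyIntegrable (fun x => f x * G x + F x * g x) := by
    have h1 : LocallyIntegrable (fun x => G x • f x) :=
      (locallyIntegrableOn_univ.1 ((locallyIntegrableOn_univ.2 hF.locInt).continuousOn_smul
        isOpen_univ.isLocallyClosed hG.continuous.continuousOn))
    have h2 : LocallyIntegrable (fun x => F x • g x) :=
      (locallyIntegrableOn_univ.1 ((locallyIntegrableOn_univ.2 hG.locInt).continuousOn_smul
        isOpen_univ.isLocallyClosed hF.continuous.continuousOn))
    convert! h1.add h2 using 2 with x
    simp [mul_comm]
  refine ⟨hloc, fun a b => ?_⟩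
  have hH : IsPrimitive (fun x => ∫ t in a..x, (f t * G t + F t * g t))
      (fun x => f x * G x + F x * g x) := ⟨hloc, fun c d =>
        intervalIntegral.integral_interval_sub_left
          (hloc.integrableOn_isCompact isCompact_uIcc).intervalIntegrable
          (hloc.integrableOn_isCompact isCompact_uIcc).intervalIntegrable⟩
  have hAC := ((hF.absolutelyContinuous a b).smul (hG.absolutelyContinuous a b)).sub
    (hH.absolutelyContinuous a b)
  -- `F G` and the integral of `f G + F g` differ by an absolutely continuous function whose
  -- derivative vanishes almost everywhere.
  obtain ⟨C, hC⟩ := hAC.const_of_ae_hasDerivAt_zero (by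
    filter_upwards [hF.ae_hasDerivAt, hG.ae_hasDerivAt, hH.ae_hasDerivAt] with x h1 h2 h3 _
    have := (h1.mul h2).sub h3
    simpa using! this)
  have ha := hC a (by simp)
  have hb := hC b (by simp)
  simp only [Pi.sub_apply, smul_eq_mul, Pi.mul_apply, intervalIntegral.integral_same] at ha hb
  linear_combination hb - ha

lemma tendsto_atTop (h : IsPrimitive F f) (hF : Integrable F) (hf : Integrable f) :
    Tendsto F atTop (𝓝 0) := by
  have h1 : Tendsto F atTop (𝓝 (F 0 + ∫ x in Set.Ioi 0, f x)) := by
    rw [h.eq_add 0]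
    simpa using tendsto_const_nhds.add
      (intervalIntegral_tendsto_integral_Ioi 0 hf.integrableOn tendsto_id)
  have h2 : IntegrableAtFilter F atTop := hF.integrableAtFilter _
  have h3 := h2.eq_zero_of_tendsto (fun s hs => by
    obtain ⟨a, ha⟩ := mem_atTop_sets.1 hs
    exact measure_mono_top (fun x hx => ha x (le_of_lt hx)) (Real.volume_Ioi (a := a))) h1
  rwa [h3] at h1

lemma tendsto_atBot (h : IsPrimitive F f) (hF : Integrable F) (hf : Integrable f) :
    Tendsto F atBot (𝓝 0) := by
  have h1 : Tendsto F atBot (𝓝 (F 0 - ∫ x in Set.Iic 0, f x)) := by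
    have : F = fun x => F 0 - ∫ t in x..0, f t := by
      ext x; rw [← h.eq_integral x 0]; ring
    rw [this]
    simpa using tendsto_const_nhds.sub
      (intervalIntegral_tendsto_integral_Iic 0 hf.integrableOn tendsto_id)
  have h2 : IntegrableAtFilter F atBot := hF.integrableAtFilter _
  have h3 := h2.eq_zero_of_tendsto (fun s hs => by
    obtain ⟨a, ha⟩ := mem_atBot_sets.1 hs
    exact measure_mono_top (fun x hx => ha x (le_of_lt hx)) (Real.volume_Iio (a := a))) h1
  rwa [h3] at h1

lemma integral_Ioi (h : IsPrimitive F f) (hF : Integrable F) (hf : Integrable f) (a : ℝ) :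
    ∫ x in Set.Ioi a, f x = - F a := by
  have h1 := intervalIntegral_tendsto_integral_Ioi a hf.integrableOn tendsto_id
  simp only [id, ← h.eq_integral] at h1
  simpa using tendsto_nhds_unique h1 ((h.tendsto_atTop hF hf).sub_const (F a))

lemma integral_Iic (h : IsPrimitive F f) (hF : Integrable F) (hf : Integrable f) (a : ℝ) :
    ∫ x in Set.Iic a, f x = F a := by
  have h1 := intervalIntegral_tendsto_integral_Iic a hf.integrableOn tendsto_id
  simp only [id, ← h.eq_integral] at h1
  simpa using tendsto_nhds_unique h1 ((h.tendsto_atBot hF hf).const_sub (F a))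

lemma integral_eq_zero (h : IsPrimitive F f) (hF : Integrable F) (hf : Integrable f) :
    ∫ x, f x = 0 := by
  rw [← intervalIntegral.integral_Iic_add_Ioi (b := 0) hf.integrableOn hf.integrableOn,
    h.integral_Iic hF hf, h.integral_Ioi hF hf, add_neg_cancel]

lemma norm_le (h : IsPrimitive F f) (hF : Integrable F) (hf : Integrable f) (x : ℝ) :
    ‖F x‖ ≤ ∫ t, ‖f t‖ := by
  rw [← h.integral_Iic hF hf x]
  refine (norm_integral_le_integral_norm _).trans
    (setIntegral_le_integral hf.norm (Eventually.of_forall fun _ => norm_nonneg _))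

end IsPrimitive

lemma IsTest.isPrimitive {φ : ℝ → ℂ} (h : IsTest φ) : IsPrimitive φ (deriv φ) :=
  .of_hasDerivAt (fun x => (h.1.differentiable (by simp) x).hasDerivAt) h.deriv_continuous

lemma IsPrimitive.integral_mul_deriv_test {F f φ : ℝ → ℂ} (h : IsPrimitive F f) (hφ : IsTest φ) :
    ∫ x, F x * deriv φ x = - ∫ x, f x * φ x := by
  have h1 : Integrable (fun x => f x * φ x) := by
    simpa [mul_comm] using h.locInt.integrable_smul_left_of_hasCompactSupport
      hφ.1.continuous hφ.2
  have h2 : Integrable (fun x => F x * deriv φ x) :=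
    (h.continuous.mul hφ.deriv_continuous).integrable_of_hasCompactSupport hφ.2.deriv.mul_left
  have h3 : Integrable (fun x => F x * φ x) :=
    (h.continuous.mul hφ.1.continuous).integrable_of_hasCompactSupport hφ.2.mul_left
  have h4 := (h.mul hφ.isPrimitive).integral_eq_zero h3 (h1.add h2)
  rw [integral_add h1 h2] at h4
  linear_combination h4

/-- A test function of integral zero is the derivative of a test function. -/
lemma exists_test_primitive {χ : ℝ → ℂ} (hχ : IsTest χ) (h0 : ∫ x, χ x = 0) :
    ∃ η, IsTest η ∧ deriv η = χ := by
  obtain ⟨R, hR⟩ := hχ.2.isCompact.isBounded.subset_closedBall 0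
  have hsupp : ∀ x, R < |x| → χ x = 0 := by
    intro x hx
    by_contra hne
    have := hR (subset_tsupport _ hne)
    simp at this
    linarith
  have hc := hχ.1.continuous
  set η : ℝ → ℂ := fun x => ∫ t in Set.Iic x, χ t with hη
  have hint : Integrable χ := hc.integrable_of_hasCompactSupport hχ.2
  have hder : ∀ x, HasDerivAt η (χ x) x := by
    intro x
    have h1 : η = fun x => (∫ t in Set.Iic 0, χ t) + ∫ t in (0:ℝ)..x, χ t := by
      ext x
      have := intervalIntegral.integral_Iic_sub_Iic (a := 0) (b := x) hint.integrableOn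
        hint.integrableOn
      rw [hη, ← this]; ring
    rw [h1]
    exact (intervalIntegral.integral_hasDerivAt_right (hc.intervalIntegrable _ _)
      (hc.stronglyMeasurableAtFilter _ _) hc.continuousAt).const_add _
  have hd : deriv η = χ := funext fun x => (hder x).deriv
  refine ⟨η, ⟨?_, ?_⟩, hd⟩
  · rw [contDiff_infty_iff_deriv, hd]
    exact ⟨fun x => (hder x).differentiableAt, hχ.1⟩
  · refine HasCompactSupport.intro (isCompact_closedBall (0:ℝ) R) fun x hx => ?_
    simp only [Metric.mem_closedBall, dist_zero_right, Real.norm_eq_abs, not_le] at hx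
    rcases lt_abs.1 hx with h | h
    · have h2 : ∫ t in Set.Ioi x, χ t = 0 := by
        refine setIntegral_eq_zero_of_forall_eq_zero fun t ht => hsupp t ?_
        exact lt_of_lt_of_le (h.trans ht) (le_abs_self t)
      have h3 := intervalIntegral.integral_Iic_add_Ioi (b := x) hint.integrableOn
        hint.integrableOn
      rw [h2, h0] at h3
      simpa using h3
    · refine setIntegral_eq_zero_of_forall_eq_zero fun t ht => hsupp t ?_
      have : t ≤ x := ht
      exact lt_of_lt_of_le (by linarith) (neg_le_abs t)

/-- The lemma of du Bois-Reymond: a function with vanishing weak derivative is constant. -/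
lemma ae_const_of_integral_mul_deriv_eq_zero {k : ℝ → ℂ} (hk : LocallyIntegrable k)
    (h : ∀ φ, IsTest φ → ∫ x, k x * deriv φ x = 0) : ∃ c, ∀ᵐ x, k x = c := by
  let b : ContDiffBump (0:ℝ) := ⟨1, 2, one_pos, one_lt_two⟩
  let ψ : ℝ → ℂ := fun x => (b.normed volume x : ℂ)
  have hof : ∀ g : ℝ → ℝ, ContDiff ℝ ∞ g → HasCompactSupport g → IsTest (fun x => (g x : ℂ)) :=
    fun g hg hs => ⟨Complex.ofRealCLM.contDiff.comp hg, hs.comp_left (g := Complex.ofReal) rfl⟩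
  have hψ : IsTest ψ := hof _ b.contDiff_normed b.hasCompactSupport_normed
  have hψ1 : ∫ x, ψ x = 1 := by
    simp only [ψ, integral_complex_ofReal, b.integral_normed, Complex.ofReal_one]
  refine ⟨∫ x, k x * ψ x, ?_⟩
  set c := ∫ x, k x * ψ x with hcdef
  have key := ae_eq_zero_of_integral_contDiff_smul_eq_zero (μ := (volume : Measure ℝ))
    (f := fun x => k x - c) (hk.sub (locallyIntegrable_const c)) (fun g hg hs => by
      have hgt := hof g hg hs
      set m : ℂ := ∫ x, (g x : ℂ) with hm
      have i1 : Integrable (fun x => (g x : ℂ)) :=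
        hgt.1.continuous.integrable_of_hasCompactSupport hgt.2
      have i2 : Integrable ψ := hψ.1.continuous.integrable_of_hasCompactSupport hψ.2
      have ik : ∀ φ, IsTest φ → Integrable (fun x => k x * φ x) := fun φ hφ => by
        simpa [mul_comm] using hk.integrable_smul_left_of_hasCompactSupport hφ.1.continuous hφ.2
      -- Subtracting a multiple of the bump `ψ` makes the integral of `g` vanish.
      obtain ⟨η, hη, hd⟩ := exists_test_primitive (χ := fun x => (g x : ℂ) - m * ψ x)
        ⟨hgt.1.sub (contDiff_const.mul hψ.1), hgt.2.sub hψ.2.mul_left⟩ (by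
          rw [integral_sub i1 (i2.const_mul _), integral_const_mul, hψ1, hm]; ring)
      have h1 := h η hη
      rw [hd] at h1
      have h2 : ∫ x, k x * ((g x : ℂ) - m * ψ x) = (∫ x, k x * g x) - m * c := by
        rw [hcdef, ← integral_const_mul, ← integral_sub (ik _ hgt) ((ik _ hψ).const_mul _)]
        congr 1; ext x; ring
      have h3 : ∫ x, g x • (k x - c) = (∫ x, k x * g x) - c * m := by
        rw [hm, ← integral_const_mul, ← integral_sub (ik _ hgt) (i1.const_mul _)]
        congr 1; ext x; simp only [Complex.real_smul]; ring
      rw [h3, mul_comm c m, ← h2, h1])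
  filter_upwards [key] with x hx
  exact sub_eq_zero.1 hx

/-! ### The space `H¹` -/

lemma integral_norm_mul_norm_le (f g : L2) : ∫ x, ‖f x‖ * ‖g x‖ ≤ ‖f‖ * ‖g‖ := by
  have hf := (Lp.memLp f).norm
  have hg := (Lp.memLp g).norm
  have h := real_inner_le_norm (hf.toLp _) (hg.toLp _)
  rw [Lp.norm_toLp, Lp.norm_toLp, eLpNorm_norm, eLpNorm_norm, ← Lp.norm_def, ← Lp.norm_def,
    L2.inner_def] at h
  refine (integral_congr_ae ?_).trans_le h
  filter_upwards [hf.coeFn_toLp, hg.coeFn_toLp] with x h1 h2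
  simp [h1, h2, mul_comm]

lemma integrable_norm_mul_norm (f g : L2) : Integrable (fun x => ‖f x‖ * ‖g x‖) :=
  MemLp.integrable_mul (p := 2) (q := 2) (Lp.memLp f).norm (Lp.memLp g).norm

/-- Multiplication by a bounded real weight, as an operator on `L²`. -/
def weight (w : ℝ → ℝ) (hw : MemLp w ∞) : L2 →L[ℂ] L2 :=
  (ContinuousLinearMap.mul ℂ ℂ).holderL volume ∞ 2 2 (hw.ofReal (K := ℂ)).toLp

lemma coeFn_weight {w : ℝ → ℝ} (hw : MemLp w ∞) (f : L2) :
    weight w hw f =ᵐ[volume] fun x => (w x : ℂ) * f x := by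
  have h := (ContinuousLinearMap.mul ℂ ℂ).coeFn_holder (r := 2) (hw.ofReal (K := ℂ)).toLp f
  filter_upwards [h, (hw.ofReal (K := ℂ)).coeFn_toLp] with x h1 h2
  rw [weight, ContinuousLinearMap.holderL_apply_apply, h1, h2]
  rfl

lemma norm_weight_le {w : ℝ → ℝ} (hw : MemLp w ∞) {C : ℝ} (hC : ∀ x, |w x| ≤ C) (f : L2) :
    ‖weight w hw f‖ ≤ C * ‖f‖ := by
  refine Lp.norm_le_mul_norm_of_ae_le_mul ?_
  filter_upwards [coeFn_weight hw f] with x hx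
  rw [hx, norm_mul, Complex.norm_real]
  exact mul_le_mul_of_nonneg_right (hC x) (norm_nonneg _)

lemma inner_weight_right {w : ℝ → ℝ} (hw : MemLp w ∞) (f g : L2) :
    inner ℂ f (weight w hw g) = ∫ x, starRingEnd ℂ (f x) * ((w x : ℂ) * g x) := by
  rw [L2.inner_def]
  refine integral_congr_ae ?_
  filter_upwards [coeFn_weight hw g] with x hx
  rw [hx, RCLike.inner_apply, mul_comm]

lemma integrable_inner_weight {w : ℝ → ℝ} (hw : MemLp w ∞) (f g : L2) :
    Integrable fun x => starRingEnd ℂ (f x) * ((w x : ℂ) * g x) := by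
  refine (L2.integrable_inner (𝕜 := ℂ) f (weight w hw g)).congr ?_
  filter_upwards [coeFn_weight hw g] with x hx
  rw [hx, RCLike.inner_apply, mul_comm]

lemma inner_weight_left {w : ℝ → ℝ} (hw : MemLp w ∞) (f g : L2) :
    inner ℂ (weight w hw f) g = inner ℂ f (weight w hw g) := by
  rw [inner_weight_right, L2.inner_def]
  refine integral_congr_ae ?_
  filter_upwards [coeFn_weight hw f] with x hx
  rw [hx, RCLike.inner_apply, map_mul, Complex.conj_ofReal]
  ring

/-- `fn` as a continuous linear map. -/
def fnL : H1 →L[ℂ] L2 := (WithLp.fstL 2 ℂ L2 L2).comp H1.subtypeL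

/-- `weakDx` as a continuous linear map. -/
def dxL : H1 →L[ℂ] L2 := (WithLp.sndL 2 ℂ L2 L2).comp H1.subtypeL

@[fun_prop] lemma continuous_fn : Continuous fn := fnL.continuous
@[fun_prop] lemma continuous_weakDx : Continuous weakDx := dxL.continuous

lemma fn_add (f g : H1) : fn (f + g) = fn f + fn g := map_add fnL f g
lemma fn_sub (f g : H1) : fn (f - g) = fn f - fn g := map_sub fnL f g
lemma weakDx_add (f g : H1) : weakDx (f + g) = weakDx f + weakDx g := map_add dxL f g
lemma fn_smul (c : ℝ) (f : H1) : fn (c • f) = c • fn f := fnL.map_smul_of_tower c f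
lemma weakDx_smul (c : ℝ) (f : H1) : weakDx (c • f) = c • weakDx f := dxL.map_smul_of_tower c f

lemma norm_sq_eq (f : H1) : ‖f‖ ^ 2 = ‖fn f‖ ^ 2 + ‖weakDx f‖ ^ 2 :=
  WithLp.prod_norm_sq_eq_of_L2 (f : WithLp 2 (L2 × L2))

lemma norm_fn_le (f : H1) : ‖fn f‖ ≤ ‖f‖ := by
  have := norm_sq_eq f
  exact abs_le_of_sq_le_sq' (by nlinarith [sq_nonneg ‖weakDx f‖]) (norm_nonneg _) |>.2

lemma norm_weakDx_le (f : H1) : ‖weakDx f‖ ≤ ‖f‖ := by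
  have := norm_sq_eq f
  exact abs_le_of_sq_le_sq' (by nlinarith [sq_nonneg ‖fn f‖]) (norm_nonneg _) |>.2

lemma norm_le_fn_add_weakDx (f : H1) : ‖f‖ ≤ ‖fn f‖ + ‖weakDx f‖ := by
  have := norm_sq_eq f
  exact abs_le_of_sq_le_sq' (by nlinarith [mul_nonneg (norm_nonneg (fn f)) (norm_nonneg (weakDx f))])
    (by positivity) |>.2

/-- The pairing `f ↦ ∫ f ψ` on `L²`. -/
def pairing (ψ : ℝ → ℂ) (hψ : MemLp ψ 2) : L2 →L[ℂ] ℂ :=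
  ((ContinuousLinearMap.mul ℂ ℂ).lpPairing volume 2 2).flip hψ.toLp

lemma pairing_apply {ψ : ℝ → ℂ} (hψ : MemLp ψ 2) (f : L2) :
    pairing ψ hψ f = ∫ x, f x * ψ x := by
  rw [pairing, ContinuousLinearMap.flip_apply, ContinuousLinearMap.lpPairing_eq_integral]
  refine integral_congr_ae ?_
  filter_upwards [hψ.coeFn_toLp] with x hx
  rw [hx]
  rfl

lemma IsTest.memLp {φ : ℝ → ℂ} (h : IsTest φ) : MemLp φ 2 :=
  h.1.continuous.memLp_of_hasCompactSupport h.2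

lemma IsTest.memLp_deriv {φ : ℝ → ℂ} (h : IsTest φ) : MemLp (deriv φ) 2 :=
  h.deriv_continuous.memLp_of_hasCompactSupport h.2.deriv

lemma isClosed_H1 : IsClosed (H1 : Set (WithLp 2 (L2 × L2))) := by
  have : (H1 : Set (WithLp 2 (L2 × L2))) = ⋂ (φ : ℝ → ℂ) (hφ : IsTest φ),
      {p | pairing _ hφ.memLp_deriv (WithLp.fstL 2 ℂ L2 L2 p)
        = - pairing _ hφ.memLp (WithLp.sndL 2 ℂ L2 L2 p)} := by
    ext p
    simp only [Set.mem_iInter, Set.mem_ofPred_eq, pairing_apply]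
    rfl
  rw [this]
  refine isClosed_iInter fun φ => isClosed_iInter fun hφ => isClosed_eq ?_ ?_ <;> fun_prop

instance : CompleteSpace H1 := isClosed_H1.completeSpace_coe

lemma locallyIntegrable_coeFn (f : L2) : LocallyIntegrable f :=
  (Lp.memLp f).locallyIntegrable (by norm_num)

/-- An element of `H¹` has a locally absolutely continuous representative, whose derivative is the
weak one. -/
lemma exists_rep (f : H1) : ∃ F : ℝ → ℂ, F =ᵐ[volume] fn f ∧ IsPrimitive F (weakDx f) := by
  have hloc := locallyIntegrable_coeFn (weakDx f)
  have hG : IsPrimitive (fun x => ∫ t in (0:ℝ)..x, weakDx f t) (weakDx f) := ⟨hloc, fun c d =>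
    intervalIntegral.integral_interval_sub_left
      (hloc.integrableOn_isCompact isCompact_uIcc).intervalIntegrable
      (hloc.integrableOn_isCompact isCompact_uIcc).intervalIntegrable⟩
  set G : ℝ → ℂ := fun x => ∫ t in (0:ℝ)..x, weakDx f t
  obtain ⟨c, hc⟩ := ae_const_of_integral_mul_deriv_eq_zero
    (k := fun x => fn f x - G x)
    ((locallyIntegrable_coeFn (fn f)).sub hG.continuous.locallyIntegrable) (fun φ hφ => by
      have h1 : Integrable fun x => G x * deriv φ x :=
        (hG.continuous.mul hφ.deriv_continuous).integrable_of_hasCompactSupport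
          hφ.2.deriv.mul_left
      simp only [sub_mul]
      rw [integral_sub (integrable_mul_test _ hφ.deriv_continuous hφ.2.deriv) h1,
        hG.integral_mul_deriv_test hφ]
      have h2 : ∫ x, fn f x * deriv φ x = - ∫ x, weakDx f x * φ x := f.2 φ hφ
      rw [h2]; ring)
  refine ⟨fun x => c + G x, ?_, ?_⟩
  · filter_upwards [hc] with x hx
    rw [← hx]; ring
  · simpa using (IsPrimitive.const c).add hG

/-- The continuous representative of an element of `H¹`. -/
def rep (f : H1) : ℝ → ℂ := (exists_rep f).choose

lemma rep_ae (f : H1) : rep f =ᵐ[volume] fn f := (exists_rep f).choose_spec.1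

lemma isPrimitive_rep (f : H1) : IsPrimitive (rep f) (weakDx f) := (exists_rep f).choose_spec.2

lemma continuous_rep (f : H1) : Continuous (rep f) := (isPrimitive_rep f).continuous

lemma memLp_rep (f : H1) : MemLp (rep f) 2 := (memLp_congr_ae (rep_ae f)).2 (Lp.memLp _)

lemma rep_eq {f : H1} {F : ℝ → ℂ} (hF : Continuous F) (h : F =ᵐ[volume] fn f) : rep f = F :=
  ((continuous_rep f).ae_eq_iff_eq volume hF).1 ((rep_ae f).trans h.symm)

/-- The continuous representative determines the weak derivative too. -/
lemma ext_rep {f g : H1} (h : rep f = rep g) : f = g := by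
  have h1 : fn f = fn g := Lp.ext ((rep_ae f).symm.trans (h ▸ rep_ae g))
  have h2 : weakDx f = weakDx g := by
    refine Lp.ext ?_
    filter_upwards [(isPrimitive_rep f).ae_hasDerivAt, (isPrimitive_rep g).ae_hasDerivAt]
      with x hf hg
    rw [h] at hf
    exact hf.unique hg
  exact Subtype.ext ((WithLp.equiv 2 _).injective (Prod.ext h1 h2))

lemma rep_add (f g : H1) : rep (f + g) = rep f + rep g := by
  refine rep_eq ((continuous_rep f).add (continuous_rep g)) ?_
  rw [fn_add]
  exact ((rep_ae f).add (rep_ae g)).trans (Lp.coeFn_add _ _).symm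

lemma rep_smul (c : ℝ) (f : H1) : rep (c • f) = c • rep f := by
  refine rep_eq ((continuous_rep f).const_smul c) ?_
  rw [fn_smul]
  exact ((rep_ae f).const_smul c).trans (Lp.coeFn_smul _ _).symm

/-- The element of `H¹` given by a square integrable primitive of a square integrable function. -/
def ofPrimitive {F f : ℝ → ℂ} (h : IsPrimitive F f) (hF : MemLp F 2) (hf : MemLp f 2) : H1 :=
  ⟨WithLp.toLp 2 (hF.toLp, hf.toLp), fun φ hφ => by
    have h1 : ∫ x, (hF.toLp : L2) x * deriv φ x = ∫ x, F x * deriv φ x :=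
      integral_congr_ae (hF.coeFn_toLp.mono fun x hx => by simp only [hx])
    have h2 : ∫ x, (hf.toLp : L2) x * φ x = ∫ x, f x * φ x :=
      integral_congr_ae (hf.coeFn_toLp.mono fun x hx => by simp only [hx])
    exact h1.trans ((h.integral_mul_deriv_test hφ).trans (congrArg _ h2.symm))⟩

lemma rep_ofPrimitive {F f : ℝ → ℂ} (h : IsPrimitive F f) (hF : MemLp F 2) (hf : MemLp f 2) :
    rep (ofPrimitive h hF hf) = F :=
  rep_eq h.continuous hF.coeFn_toLp.symm

lemma norm_mul_conj_add_le (z w : ℂ) :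
    ‖w * starRingEnd ℂ z + z * starRingEnd ℂ w‖ ≤ 2 * (‖z‖ * ‖w‖) := by
  refine (norm_add_le _ _).trans (le_of_eq ?_)
  simp only [norm_mul, RCLike.norm_conj]
  ring

/-- The Sobolev embedding `H¹ ⊂ L^∞` in multiplicative form. -/
lemma norm_rep_sq_le_mul (f : H1) (x : ℝ) : ‖rep f x‖ ^ 2 ≤ 2 * (‖fn f‖ * ‖weakDx f‖) := by
  have hP := (isPrimitive_rep f).mul (isPrimitive_rep f).conj
  have hint : Integrable fun x => 2 * (‖rep f x‖ * ‖weakDx f x‖) :=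
    (((integrable_norm_mul_norm (fn f) (weakDx f)).congr
      ((rep_ae f).mono fun x hx => by simp only [hx]))).const_mul 2
  have h1 : Integrable fun x => rep f x * starRingEnd ℂ (rep f x) :=
    MemLp.integrable_mul (p := 2) (q := 2) (memLp_rep f) (memLp_rep f).star
  have hle : ∀ x, ‖weakDx f x * starRingEnd ℂ (rep f x) + rep f x * starRingEnd ℂ (weakDx f x)‖
      ≤ 2 * (‖rep f x‖ * ‖weakDx f x‖) := fun x => norm_mul_conj_add_le _ _
  have h2 : Integrable fun x => weakDx f x * starRingEnd ℂ (rep f x)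
      + rep f x * starRingEnd ℂ (weakDx f x) := by
    refine hint.mono' hP.locInt.aestronglyMeasurable (Eventually.of_forall hle)
  have h3 := hP.norm_le h1 h2 x
  rw [norm_mul, RCLike.norm_conj, ← sq] at h3
  refine h3.trans ((integral_mono h2.norm hint hle).trans ?_)
  rw [integral_const_mul]
  refine mul_le_mul_of_nonneg_left ?_ (by norm_num)
  refine (integral_congr_ae ?_).trans_le (integral_norm_mul_norm_le (fn f) (weakDx f))
  filter_upwards [rep_ae f] with x hx
  simp only [hx]

lemma norm_rep_le (f : H1) (x : ℝ) : ‖rep f x‖ ≤ ‖f‖ := by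
  have h1 := norm_rep_sq_le_mul f x
  have h2 := norm_sq_eq f
  exact abs_le_of_sq_le_sq' (by nlinarith [sq_nonneg (‖fn f‖ - ‖weakDx f‖)]) (norm_nonneg _) |>.2

lemma memLp_top_rep (f : H1) : MemLp (rep f) ∞ :=
  memLp_top_of_bound (continuous_rep f).aestronglyMeasurable ‖f‖
    (Eventually.of_forall (norm_rep_le f))

lemma memLp_rep_mul (f : H1) {g : ℝ → ℂ} (hg : MemLp g 2) : MemLp (fun x => rep f x * g x) 2 :=
  hg.mul (p := ∞) (q := 2) (memLp_top_rep f)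

lemma norm_toLp_rep_mul_le (f : H1) (g : L2) {G : ℝ → ℂ} (hG : MemLp G 2)
    (h : ∀ᵐ x, ‖G x‖ ≤ ‖rep f x‖ * ‖g x‖) : ‖hG.toLp‖ ≤ ‖f‖ * ‖g‖ := by
  refine Lp.norm_le_mul_norm_of_ae_le_mul ?_
  filter_upwards [h, hG.coeFn_toLp] with x h1 h2
  rw [h2]
  exact h1.trans (mul_le_mul_of_nonneg_right (norm_rep_le f x) (norm_nonneg _))

lemma memLp_mul_rep {f : ℝ → ℂ} (hf : MemLp f 2) (g : H1) : MemLp (fun x => f x * rep g x) 2 := by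
  simpa only [mul_comm] using memLp_rep_mul g hf

/-- The product of two elements of `H¹`. -/
def mulH1 (f g : H1) : H1 :=
  ofPrimitive ((isPrimitive_rep f).mul (isPrimitive_rep g)) (memLp_rep_mul f (memLp_rep g))
    ((memLp_mul_rep (Lp.memLp (weakDx f)) g).add (memLp_rep_mul f (Lp.memLp (weakDx g))))

lemma rep_mulH1 (f g : H1) : rep (mulH1 f g) = fun x => rep f x * rep g x := rep_ofPrimitive _ _ _

lemma norm_mulH1_le (f g : H1) : ‖mulH1 f g‖ ≤ 3 * ‖f‖ * ‖g‖ := by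
  have h1 : ‖fn (mulH1 f g)‖ ≤ ‖f‖ * ‖g‖ :=
    (norm_toLp_rep_mul_le f (fn g) (memLp_rep_mul f (memLp_rep g)) (by
      filter_upwards [rep_ae g] with x hx
      rw [norm_mul, hx])).trans (mul_le_mul_of_nonneg_left (norm_fn_le g) (norm_nonneg _))
  have m1 := memLp_mul_rep (Lp.memLp (weakDx f)) g
  have m2 := memLp_rep_mul f (Lp.memLp (weakDx g))
  have h2 : weakDx (mulH1 f g) = m1.toLp + m2.toLp := rfl
  have h3 : ‖m1.toLp‖ ≤ ‖g‖ * ‖weakDx f‖ := norm_toLp_rep_mul_le g (weakDx f) _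
    (Eventually.of_forall fun x => by rw [norm_mul, mul_comm])
  have h4 : ‖m2.toLp‖ ≤ ‖f‖ * ‖weakDx g‖ := norm_toLp_rep_mul_le f (weakDx g) _
    (Eventually.of_forall fun x => by rw [norm_mul])
  have h5 := mul_le_mul_of_nonneg_left (norm_weakDx_le f) (norm_nonneg g)
  have h6 := mul_le_mul_of_nonneg_left (norm_weakDx_le g) (norm_nonneg f)
  have h7 := norm_le_fn_add_weakDx (mulH1 f g)
  rw [h2] at h7
  have h8 := norm_add_le m1.toLp m2.toLp
  linarith

/-- Multiplication on `H¹` as a continuous bilinear map. -/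
def mulL : H1 →L[ℝ] H1 →L[ℝ] H1 :=
  LinearMap.mkContinuous₂ (LinearMap.mk₂ ℝ mulH1
    (fun f g h => ext_rep (by ext x; simp [rep_mulH1, rep_add, add_mul]))
    (fun c f g => ext_rep (by ext x; simp [rep_mulH1, rep_smul, mul_assoc]))
    (fun f g h => ext_rep (by ext x; simp [rep_mulH1, rep_add, mul_add]))
    (fun c f g => ext_rep (by ext x; simp [rep_mulH1, rep_smul, mul_left_comm])))
    3 norm_mulH1_le

lemma rep_mulL (f g : H1) (x : ℝ) : rep (mulL f g) x = rep f x * rep g x :=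
  congrFun (rep_mulH1 f g) x

/-- Complex conjugation of an element of `H¹`. -/
def conjH1 (f : H1) : H1 :=
  ofPrimitive (isPrimitive_rep f).conj (memLp_rep f).star (Lp.memLp (weakDx f)).star

lemma rep_conjH1 (f : H1) : rep (conjH1 f) = fun x => starRingEnd ℂ (rep f x) :=
  rep_ofPrimitive _ _ _

lemma norm_conjH1_le (f : H1) : ‖conjH1 f‖ ≤ 1 * ‖f‖ := by
  have h1 : ‖fn (conjH1 f)‖ ≤ ‖fn f‖ := by
    refine Lp.norm_le_norm_of_ae_le ?_
    filter_upwards [(memLp_rep f).star.coeFn_toLp, rep_ae f] with x hx h2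
    rw [← h2, ← norm_star (rep f x)]
    exact (congrArg norm hx).le
  have h2 : ‖weakDx (conjH1 f)‖ ≤ ‖weakDx f‖ := by
    refine Lp.norm_le_norm_of_ae_le ?_
    filter_upwards [(Lp.memLp (weakDx f)).star.coeFn_toLp] with x hx
    rw [← norm_star (weakDx f x)]
    exact (congrArg norm hx).le
  rw [one_mul]
  refine abs_le_of_sq_le_sq' ?_ (norm_nonneg _) |>.2
  rw [norm_sq_eq, norm_sq_eq]
  gcongr

/-- Complex conjugation on `H¹` as a continuous real linear map. -/
def conjL : H1 →L[ℝ] H1 :=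
  LinearMap.mkContinuous
    { toFun := conjH1
      map_add' := fun f g => ext_rep (by ext x; simp [rep_conjH1, rep_add])
      map_smul' := fun c f => ext_rep (by ext x; simp [rep_conjH1, rep_smul]) }
    1 norm_conjH1_le

lemma rep_conjL (f : H1) (x : ℝ) : rep (conjL f) x = starRingEnd ℂ (rep f x) :=
  congrFun (rep_conjH1 f) x

/-- The nonlinearity as a map of `H¹` into itself. -/
def nonlinH1 (ε : ℝ) (f : H1) : H1 :=
  mulL (mulL f (conjL f)) f + ε • mulL (mulL (mulL f (conjL f)) (mulL f (conjL f))) f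

lemma rep_nonlinH1 (ε : ℝ) (f : H1) (x : ℝ) : rep (nonlinH1 ε f) x = nonlin ε (rep f x) := by
  have h := Complex.mul_conj' (rep f x)
  simp only [nonlinH1, rep_add, rep_smul, Pi.add_apply, Pi.smul_apply, rep_mulL, rep_conjL, h,
    nonlin, Complex.real_smul]
  ring

@[fun_prop] lemma continuous_nonlinH1 (ε : ℝ) : Continuous (nonlinH1 ε) := by
  unfold nonlinH1
  fun_prop

lemma fn_nonlinH1_ae (ε : ℝ) (f : H1) :
    fn (nonlinH1 ε f) =ᵐ[volume] fun x => nonlin ε (fn f x) := by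
  filter_upwards [rep_ae f, rep_ae (nonlinH1 ε f)] with x h1 h2
  rw [← h1, ← h2, rep_nonlinH1]

/-- Integration by parts in `H¹` with a bounded weight. -/
lemma inner_weight_weakDx {w w' : ℝ → ℝ} (hw : MemLp w ∞) (hw' : MemLp w' ∞)
    (h : IsPrimitive (fun x => (w x : ℂ)) (fun x => (w' x : ℂ))) (f g : H1) :
    inner ℂ (fn f) (weight w hw (weakDx g)) =
      - inner ℂ (fn f) (weight w' hw' (fn g)) - inner ℂ (weakDx f) (weight w hw (fn g)) := by
  have hP := (isPrimitive_rep f).conj.mul (h.mul (isPrimitive_rep g))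
  have i1 := integrable_inner_weight hw (weakDx f) (fn g)
  have i2 := integrable_inner_weight hw' (fn f) (fn g)
  have i3 := integrable_inner_weight hw (fn f) (weakDx g)
  have e : (fun x => starRingEnd ℂ (weakDx f x) * ((w x : ℂ) * fn g x)
      + (starRingEnd ℂ (fn f x) * ((w' x : ℂ) * fn g x)
        + starRingEnd ℂ (fn f x) * ((w x : ℂ) * weakDx g x))) =ᵐ[volume]
      fun x => starRingEnd ℂ (weakDx f x) * ((w x : ℂ) * rep g x)
        + starRingEnd ℂ (rep f x) * ((w' x : ℂ) * rep g x + (w x : ℂ) * weakDx g x) := by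
    filter_upwards [rep_ae f, rep_ae g] with x hf hg
    rw [hf, hg]; ring
  have h0 := hP.integral_eq_zero
    ((integrable_inner_weight hw (fn f) (fn g)).congr (by
      filter_upwards [rep_ae f, rep_ae g] with x hf hg
      rw [hf, hg]))
    ((i1.add (i2.add i3)).congr e)
  rw [← integral_congr_ae e] at h0
  have h1 := integral_add i1 (i2.add i3)
  simp only [Pi.add_apply] at h1
  rw [h1, integral_add i2 i3] at h0
  rw [inner_weight_right, inner_weight_right, inner_weight_right]
  linear_combination h0

lemma weight_one (h1 : MemLp (fun _ : ℝ => (1 : ℝ)) ∞) (f : L2) : weight _ h1 f = f :=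
  Lp.ext (by filter_upwards [coeFn_weight h1 f] with x hx; simp [hx])

lemma weight_zero (h0 : MemLp (fun _ : ℝ => (0 : ℝ)) ∞) (f : L2) : weight _ h0 f = 0 :=
  Lp.ext (by
    filter_upwards [coeFn_weight h0 f, Lp.coeFn_zero ℂ 2 (volume : Measure ℝ)] with x hx h
    rw [hx, h]; simp)

lemma inner_weakDx (f g : H1) : inner ℂ (fn f) (weakDx g) = - inner ℂ (weakDx f) (fn g) := by
  have := inner_weight_weakDx (memLp_top_const 1) (memLp_top_const 0)
    (by simpa using IsPrimitive.const 1) f g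
  simpa [weight_one, weight_zero] using this

/-! ### Time averages of solutions and the localized mass -/

section avg
variable {E : Type*} [NormedAddCommGroup E] [NormedSpace ℝ E]

/-- The average of the path `z` over the time interval between `t` and `t + h`, parametrized so that
it makes sense for `h = 0` as well. -/
def avg (h : ℝ) (z : ℝ → E) (t : ℝ) : E := ∫ s in (0:ℝ)..1, z (t + h * s)

variable {z : ℝ → E}

lemma avg_zero [CompleteSpace E] (z : ℝ → E) (t : ℝ) : avg 0 z t = z t := by simp [avg]

lemma continuous_avg (hz : Continuous z) : Continuous fun p : ℝ × ℝ => avg p.1 z p.2 := by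
  unfold avg
  refine intervalIntegral.continuous_parametric_intervalIntegral_of_continuous' ?_ _ _
  fun_prop

lemma hasDerivAt_avg [CompleteSpace E] (hz : Continuous z) {h : ℝ} (hh : h ≠ 0) (t : ℝ) :
    HasDerivAt (avg h z) (h⁻¹ • (z (t + h) - z t)) t := by
  have h1 : avg h z = fun t => h⁻¹ • ((∫ s in (0:ℝ)..(t + h), z s) - ∫ s in (0:ℝ)..t, z s) := by
    ext t
    rw [avg, intervalIntegral.integral_comp_add_mul _ hh,
      intervalIntegral.integral_interval_sub_left (hz.intervalIntegrable _ _)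
      (hz.intervalIntegrable _ _)]
    simp
  have h2 : ∀ t, HasDerivAt (fun t => ∫ s in (0:ℝ)..t, z s) (z t) t := fun t =>
    intervalIntegral.integral_hasDerivAt_right (hz.intervalIntegrable _ _)
      (hz.stronglyMeasurableAtFilter _ _) hz.continuousAt
  rw [h1]
  exact (((h2 (t + h)).comp_add_const t h).sub (h2 t)).const_smul _

lemma map_avg {𝕜 F : Type*} [RCLike 𝕜] [NormedSpace 𝕜 E] [NormedAddCommGroup F] [NormedSpace ℝ F]
    [NormedSpace 𝕜 F] [CompleteSpace E] [CompleteSpace F] (L : E →L[𝕜] F) (hz : Continuous z)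
    (h t : ℝ) : L (avg h z t) = avg h (fun s => L (z s)) t := by
  unfold avg
  rw [ContinuousLinearMap.intervalIntegral_comp_comm]
  exact Continuous.intervalIntegrable (by fun_prop) _ _

/-- A differential identity that holds along all time averages of a path holds along the path:
its integrated form depends continuously on the averaging length `h`, including `h = 0`. -/
lemma hasDerivAt_of_avg [CompleteSpace E] (hz : Continuous z) {Φ Ψ : E → ℝ} (hΦ : Continuous Φ)
    (hΨ : Continuous Ψ)
    (H : ∀ h ≠ 0, ∀ t, HasDerivAt (fun s => Φ (avg h z s)) (Ψ (avg h z t)) t) (t : ℝ) :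
    HasDerivAt (fun s => Φ (z s)) (Ψ (z t)) t := by
  have hc := continuous_avg hz
  have hcz : ∀ h, Continuous (avg h z) := fun h => hc.comp (Continuous.prodMk_right h)
  have key : ∀ b, Φ (z b) = Φ (z 0) + ∫ s in (0:ℝ)..b, Ψ (z s) := by
    intro b
    have h1 : Continuous fun h => Φ (avg h z b) :=
      hΦ.comp (hc.comp (Continuous.prodMk_left b))
    have h2 : Continuous fun h => Φ (avg h z 0) + ∫ s in (0:ℝ)..b, Ψ (avg h z s) :=
      (hΦ.comp (hc.comp (Continuous.prodMk_left 0))).add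
        (intervalIntegral.continuous_parametric_intervalIntegral_of_continuous' (f := fun h s => Ψ (avg h z s))
          (hΨ.comp hc) _ _)
    have h3 := Continuous.ext_on (dense_compl_singleton (0:ℝ)) h1 h2 (fun h hh => by
      have := intervalIntegral.integral_eq_sub_of_hasDerivAt (fun t _ => H h hh t)
        ((hΨ.comp (hcz h)).intervalIntegrable 0 b)
      change Φ (avg h z b) = Φ (avg h z 0) + ∫ s in (0:ℝ)..b, Ψ (avg h z s)
      rw [this]; ring)
    simpa only [avg_zero] using congrFun h3 0
  have hΨz := hΨ.comp hz
  have e : (fun s => Φ (z s)) = fun b => Φ (z 0) + ∫ s in (0:ℝ)..b, Ψ (z s) := funext key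
  rw [e]
  exact (intervalIntegral.integral_hasDerivAt_right (hΨz.intervalIntegrable _ _)
    (hΨz.stronglyMeasurableAtFilter _ _) hΨz.continuousAt).const_add _

end avg

variable {ε : ℝ} {u : ℝ → H1}

/-- The solution paired with its nonlinearity, as a path in `H¹ × H¹`. -/
def solPath (ε : ℝ) (u : ℝ → H1) (t : ℝ) : H1 × H1 := (u t, nonlinH1 ε (u t))

lemma continuous_solPath (hu : Continuous u) : Continuous (solPath ε u) := by
  unfold solPath
  fun_prop

/-- The difference quotients of `p` are the averages of its derivative. -/
lemma avg_eq_of_hasDerivAt {p q : ℝ → ℂ} (hp : ∀ s, HasDerivAt p (q s) s) (hq : Continuous q)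
    {h : ℝ} (hh : h ≠ 0) (t : ℝ) : avg h q t = h⁻¹ • (p (t + h) - p t) := by
  have h1 := intervalIntegral.integral_eq_sub_of_hasDerivAt (fun s _ => hp s)
    (hq.intervalIntegrable t (t + h))
  rw [avg, intervalIntegral.integral_comp_add_mul _ hh, ← h1]
  simp

lemma hasDerivAt_pairing (hu : IsGlobalSolution ε u) {φ : ℝ → ℂ} (hφ : IsTest φ) (s : ℝ) :
    HasDerivAt (fun s => pairing φ hφ.memLp (fn (u s)))
      (-Complex.I * (pairing _ hφ.memLp_deriv (weakDx (u s))
        + pairing _ hφ.memLp (fn (nonlinH1 ε (u s))))) s := by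
  obtain ⟨d, hd, hde⟩ := hu.2 φ hφ s
  have i2 : ∫ x, fn (nonlinH1 ε (u s)) x * φ x = ∫ x, nonlin ε (fn (u s) x) * φ x := by
    refine integral_congr_ae ?_
    filter_upwards [fn_nonlinH1_ae ε (u s)] with x hx
    rw [hx]
  simp only [pairing_apply]
  rw [i2, ← hde]
  convert! hd using 1
  linear_combination (-d) * Complex.I_sq

/-- The functional on `H¹ × H¹` by which the equation tested against `φ` reads
`d/dt ∫ u φ = eqFunctional (u, N u)`. -/
def eqFunctional {φ : ℝ → ℂ} (hφ : IsTest φ) : H1 × H1 →L[ℂ] ℂ :=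
  -Complex.I • (((pairing _ hφ.memLp_deriv).comp dxL).comp (ContinuousLinearMap.fst ℂ H1 H1)
    + ((pairing _ hφ.memLp).comp fnL).comp (ContinuousLinearMap.snd ℂ H1 H1))

lemma eqFunctional_apply {φ : ℝ → ℂ} (hφ : IsTest φ) (z : H1 × H1) :
    eqFunctional hφ z = -Complex.I * (pairing _ hφ.memLp_deriv (weakDx z.1)
      + pairing _ hφ.memLp (fn z.2)) := rfl

/-- Time averages gain regularity: for an average `U` of the solution, the derivative `∂ₜU = D` is a
difference quotient, hence in `H¹`, so the averaged equation `D = i U_xx - i G` shows that `U_x = V`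
is in `H¹`. -/
lemma exists_avg_equation (hu : IsGlobalSolution ε u) {h : ℝ} (hh : h ≠ 0) (t : ℝ) :
    ∃ V D : H1, fn V = weakDx (avg h (solPath ε u) t).1 ∧
      fn D = Complex.I • weakDx V - Complex.I • fn (avg h (solPath ε u) t).2 ∧
      HasDerivAt (fun s => (avg h (solPath ε u) s).1) D t := by
  have hzc := continuous_solPath (ε := ε) hu.1
  have e1 : ∀ s, (avg h (solPath ε u) s).1 = avg h u s := fun s =>
    map_avg (ContinuousLinearMap.fst ℝ H1 H1) hzc h s
  set Z := avg h (solPath ε u) t with hZ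
  set D : H1 := h⁻¹ • (u (t + h) - u t) with hD
  set W : L2 := fn Z.2 - Complex.I • fn D with hW
  have hweak : IsWeakDeriv (weakDx Z.1) W := by
    intro φ hφ
    have m1 : pairing _ hφ.memLp (fn D) = -Complex.I * (pairing _ hφ.memLp_deriv (weakDx Z.1)
        + pairing _ hφ.memLp (fn Z.2)) := by
      have h1 := avg_eq_of_hasDerivAt (p := fun s => pairing φ hφ.memLp (fn (u s)))
        (q := fun s => eqFunctional hφ (solPath ε u s))
        (fun s => by simpa only [eqFunctional_apply, solPath] using hasDerivAt_pairing hu hφ s)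
        ((eqFunctional hφ).continuous.comp hzc) hh t
      rw [← eqFunctional_apply hφ, hZ, map_avg (eqFunctional hφ) hzc, h1, hD, fn_smul,
        ContinuousLinearMap.map_smul_of_tower, fn_sub, map_sub]
    rw [← pairing_apply hφ.memLp_deriv, ← pairing_apply hφ.memLp, hW, map_sub, map_smul, m1,
      smul_eq_mul]
    linear_combination (pairing _ hφ.memLp_deriv (weakDx Z.1) + pairing _ hφ.memLp (fn Z.2))
      * Complex.I_sq
  refine ⟨⟨WithLp.toLp 2 (weakDx Z.1, W), hweak⟩, D, rfl, ?_, ?_⟩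
  · change fn D = Complex.I • W - _
    rw [hW, smul_sub, smul_smul, Complex.I_mul_I]
    simp
  · simp only [e1]
    exact hasDerivAt_avg hu.1 hh t

lemma inner_weight_symm {w : ℝ → ℝ} (hw : MemLp w ∞) (f g : L2) :
    inner ℂ f (weight w hw g) = starRingEnd ℂ (inner ℂ g (weight w hw f)) := by
  rw [inner_conj_symm, inner_weight_left]

lemma re_inner_weight_symm {w : ℝ → ℝ} (hw : MemLp w ∞) (f g : L2) :
    (inner ℂ f (weight w hw g)).re = (inner ℂ g (weight w hw f)).re := by
  rw [inner_weight_symm, Complex.conj_re]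

lemma im_inner_weight_symm {w : ℝ → ℝ} (hw : MemLp w ∞) (f g : L2) :
    (inner ℂ f (weight w hw g)).im = - (inner ℂ g (weight w hw f)).im := by
  rw [inner_weight_symm, Complex.conj_im]

lemma im_inner_weight_self {w : ℝ → ℝ} (hw : MemLp w ∞) (f : L2) :
    (inner ℂ f (weight w hw f)).im = 0 := by
  have := im_inner_weight_symm hw f f
  linarith

lemma hasDerivAt_fn {U : ℝ → H1} {D : H1} {t : ℝ} (h : HasDerivAt U D t) :
    HasDerivAt (fun s => fn (U s)) (fn D) t :=
  (fnL.restrictScalars ℝ).hasFDerivAt.comp_hasDerivAt t h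

lemma hasDerivAt_weakDx {U : ℝ → H1} {D : H1} {t : ℝ} (h : HasDerivAt U D t) :
    HasDerivAt (fun s => weakDx (U s)) (weakDx D) t :=
  (dxL.restrictScalars ℝ).hasFDerivAt.comp_hasDerivAt t h

lemma hasDerivAt_weight {w : ℝ → ℝ} (hw : MemLp w ∞) {f : ℝ → L2} {f' : L2} {t : ℝ}
    (h : HasDerivAt f f' t) : HasDerivAt (fun s => weight w hw (f s)) (weight w hw f') t :=
  ((weight w hw).restrictScalars ℝ).hasFDerivAt.comp_hasDerivAt t h

lemma hasDerivAt_re {f : ℝ → ℂ} {f' : ℂ} {t : ℝ} (h : HasDerivAt f f' t) :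
    HasDerivAt (fun s => (f s).re) f'.re t :=
  Complex.reCLM.hasFDerivAt.comp_hasDerivAt t h

lemma hasDerivAt_im {f : ℝ → ℂ} {f' : ℂ} {t : ℝ} (h : HasDerivAt f f' t) :
    HasDerivAt (fun s => (f s).im) f'.im t :=
  Complex.imCLM.hasFDerivAt.comp_hasDerivAt t h

/-- The nonlinearity does not contribute to the mass balance: `f̄ N(f)` is real. -/
lemma im_inner_weight_nonlin {w : ℝ → ℝ} (hw : MemLp w ∞) (f : H1) :
    (inner ℂ (fn f) (weight w hw (fn (nonlinH1 ε f)))).im = 0 := by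
  have h := integral_im (integrable_inner_weight hw (fn f) (fn (nonlinH1 ε f)))
  rw [inner_weight_right]
  refine h.symm.trans (integral_eq_zero_of_ae ?_)
  filter_upwards [fn_nonlinH1_ae ε f] with x hx
  rw [hx, nonlin]
  have e := Complex.conj_mul' (fn f x)
  have e2 : starRingEnd ℂ (fn f x) * ((w x : ℂ) * ((‖fn f x‖ : ℂ) ^ 2 * fn f x
      + (ε : ℂ) * (‖fn f x‖ : ℂ) ^ 4 * fn f x))
      = ((w x * (‖fn f x‖ ^ 2 + ε * ‖fn f x‖ ^ 4) * ‖fn f x‖ ^ 2 : ℝ) : ℂ) := by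
    push_cast
    rw [← e]; ring
  rw [e2]
  exact RCLike.ofReal_im (K := ℂ) _

/-- The localized conservation law of mass. -/
lemma hasDerivAt_localMass (hu : IsGlobalSolution ε u) {w w' : ℝ → ℝ} (hw : MemLp w ∞)
    (hw' : MemLp w' ∞) (h : IsPrimitive (fun x => (w x : ℂ)) (fun x => (w' x : ℂ))) (t : ℝ) :
    HasDerivAt (fun t => (inner ℂ (fn (u t)) (weight w hw (fn (u t)))).re)
      (2 * (inner ℂ (fn (u t)) (weight w' hw' (weakDx (u t)))).im) t := by
  have key := hasDerivAt_of_avg (continuous_solPath (ε := ε) hu.1)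
    (Φ := fun z => (inner ℂ (fn z.1) (weight w hw (fn z.1))).re)
    (Ψ := fun z => 2 * (inner ℂ (fn z.1) (weight w' hw' (weakDx z.1))).im
      + 2 * (inner ℂ (fn z.1) (weight w hw (fn z.2))).im)
    (by fun_prop) (by fun_prop) (fun k hk t => by
      obtain ⟨V, D, hV, hD, hder⟩ := exists_avg_equation hu hk t
      have h1 := hasDerivAt_fn hder
      have h2 := hasDerivAt_re (h1.inner ℂ (hasDerivAt_weight hw h1))
      convert! h2 using 1
      set U := (avg k (solPath ε u) t).1
      set G := (avg k (solPath ε u) t).2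
      have h3 := inner_weight_weakDx hw hw' h U V
      rw [← hV] at h3
      rw [Complex.add_re, re_inner_weight_symm hw (fn D), hD, ← hV, map_sub, map_smul, map_smul,
        inner_sub_right, inner_smul_right, inner_smul_right, h3]
      -- Integration by parts leaves the real quantity `∫ w |V|²`, which drops out.
      have h4 := im_inner_weight_self hw (fn V)
      simp [h4]
      ring) t
  simpa [solPath, im_inner_weight_nonlin] using key

/-! ### Energy and virial identities -/

lemma inner_fn (f g : H1) : inner ℂ (fn f) (fn g) = ∫ x, rep g x * starRingEnd ℂ (rep f x) := by
  rw [L2.inner_def]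
  refine integral_congr_ae ?_
  filter_upwards [rep_ae f, rep_ae g] with x hf hg
  rw [hf, hg, RCLike.inner_apply]

lemma hasDerivAt_norm_sq {f : ℝ → L2} {f' : L2} {t : ℝ} (h : HasDerivAt f f' t) :
    HasDerivAt (fun s => ‖f s‖ ^ 2) (2 * (inner ℂ (f t) f').re) t := by
  have e : (fun s => ‖f s‖ ^ 2) = fun s => (inner ℂ (f s) (f s)).re :=
    funext fun s => norm_sq_eq_re_inner (𝕜 := ℂ) (f s)
  rw [e]
  convert! hasDerivAt_re (h.inner ℂ h) using 1
  rw [Complex.add_re, ← inner_conj_symm f' (f t), Complex.conj_re]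
  ring

/-- The energy `½ ‖u_x‖² + ¼ ∫ |u|⁴ + (ε/6) ∫ |u|⁶`; the powers of `|u|` are written as `|u²|²` and
`|u³|²`, which makes the energy a polynomial on `H¹`. -/
def energy (ε : ℝ) (f : H1) : ℝ :=
  1 / 2 * ‖weakDx f‖ ^ 2 + 1 / 4 * ‖fn (mulL f f)‖ ^ 2 + ε / 6 * ‖fn (mulL (mulL f f) f)‖ ^ 2

@[fun_prop] lemma continuous_energy (ε : ℝ) : Continuous (energy ε) := by
  unfold energy
  fun_prop

lemma inner_mulL_mulL (f g : H1) : inner ℂ (fn (mulL f f)) (fn (mulL f g))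
    = inner ℂ (fn (mulL (mulL f (conjL f)) f)) (fn g) := by
  simp only [inner_fn, rep_mulL, rep_conjL, map_mul, Complex.conj_conj]
  congr 1; ext x; ring

lemma inner_mulL_mulL_mulL (f g : H1) :
    inner ℂ (fn (mulL (mulL f f) f)) (fn (mulL (mulL f f) g))
      = inner ℂ (fn (mulL (mulL (mulL f (conjL f)) (mulL f (conjL f))) f)) (fn g) := by
  simp only [inner_fn, rep_mulL, rep_conjL, map_mul, Complex.conj_conj]
  congr 1; ext x; ring

lemma hasDerivAt_bilin {E : Type*} [NormedAddCommGroup E] [NormedSpace ℝ E] (B : E →L[ℝ] E →L[ℝ] E)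
    {U V : ℝ → E} {D D' : E} {t : ℝ} (hU : HasDerivAt U D t) (hV : HasDerivAt V D' t) :
    HasDerivAt (fun s => B (U s) (V s)) (B D (V t) + B (U t) D') t := by
  have h1 : HasDerivAt (fun s => B (U s)) (B D) t := B.hasFDerivAt.comp_hasDerivAt t hU
  exact h1.clm_apply hV

lemma hasDerivAt_mulL {U V : ℝ → H1} {D E : H1} {t : ℝ} (hU : HasDerivAt U D t)
    (hV : HasDerivAt V E t) :
    HasDerivAt (fun s => mulL (U s) (V s)) (mulL D (V t) + mulL (U t) E) t :=
  hasDerivAt_bilin mulL hU hV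

lemma mulL_comm (f g : H1) : mulL f g = mulL g f :=
  ext_rep (by ext x; rw [rep_mulL, rep_mulL, mul_comm])

lemma mulL_right_comm (f g k : H1) : mulL (mulL f g) k = mulL (mulL f k) g :=
  ext_rep (by ext x; simp only [rep_mulL]; ring)

lemma hasDerivAt_energy {U : ℝ → H1} {D : H1} {t : ℝ} (hU : HasDerivAt U D t) :
    HasDerivAt (fun s => energy ε (U s)) ((inner ℂ (weakDx (U t)) (weakDx D)).re
      + (inner ℂ (fn (nonlinH1 ε (U t))) (fn D)).re) t := by
  have h1 := hasDerivAt_norm_sq (hasDerivAt_weakDx hU)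
  have h2 := hasDerivAt_mulL hU hU
  have h3 := hasDerivAt_norm_sq (hasDerivAt_fn h2)
  have h4 := hasDerivAt_norm_sq (hasDerivAt_fn (hasDerivAt_mulL h2 hU))
  convert! ((h1.const_mul (1 / 2)).add (h3.const_mul (1 / 4))).add (h4.const_mul (ε / 6)) using 1
  rw [mulL_comm D (U t), map_add, add_apply, mulL_right_comm (U t) D]
  simp only [nonlinH1, fn_add, fn_smul, inner_add_left, inner_add_right, inner_mulL_mulL,
    inner_mulL_mulL_mulL, Complex.add_re, inner_smul_left_eq_smul,
    Complex.smul_re, smul_eq_mul]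
  ring

/-- Conservation of energy. For the averages `U`, the derivative of the energy only involves
`N(U)_x - G_x` and `Im ⟨N(U), G⟩`, where `G` is the average of `N(u)`; both vanish in the limit. -/
lemma hasDerivAt_energy_solution (hu : IsGlobalSolution ε u) (t : ℝ) :
    HasDerivAt (fun t => energy ε (u t)) 0 t := by
  have key := hasDerivAt_of_avg (continuous_solPath (ε := ε) hu.1)
    (Φ := fun z => energy ε z.1)
    (Ψ := fun z => (inner ℂ (weakDx (nonlinH1 ε z.1)) (weakDx z.1)).im
      - (inner ℂ (weakDx z.2) (weakDx z.1)).im + (inner ℂ (fn (nonlinH1 ε z.1)) (fn z.2)).im)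
    (by fun_prop) (by fun_prop) (fun k hk t => by
      obtain ⟨V, D, hV, hD, hder⟩ := exists_avg_equation hu hk t
      convert! hasDerivAt_energy hder using 1
      set U := (avg k (solPath ε u) t).1
      set G := (avg k (solPath ε u) t).2
      have h1 := congrArg Complex.im (inner_weakDx (nonlinH1 ε U) V)
      have h2 := congrArg Complex.im (inner_weakDx G V)
      have h3 : (inner ℂ (weakDx V) (fn G)).im = - (inner ℂ (fn G) (weakDx V)).im := by
        rw [← inner_conj_symm, Complex.conj_im]
      have h4 : (inner ℂ (weakDx V) (weakDx V)).im = 0 := inner_self_im (𝕜 := ℂ) (weakDx V)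
      rw [hV] at h1 h2
      rw [← hV, inner_weakDx V D, hD, hV]
      simp only [inner_sub_right, inner_smul_right, Complex.sub_re, Complex.mul_re, Complex.neg_re,
        Complex.neg_im, Complex.I_re, Complex.I_im] at *
      linarith) t
  have h0 : (inner ℂ (fn (nonlinH1 ε (u t))) (fn (nonlinH1 ε (u t)))).im = 0 :=
    inner_self_im (𝕜 := ℂ) _
  simp only [solPath, h0, sub_self, add_zero] at key
  exact key

/-- The virial identity. -/
lemma hasDerivAt_virial (hu : IsGlobalSolution ε u) {w w' w'' : ℝ → ℝ} (hw : MemLp w ∞)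
    (hw' : MemLp w' ∞) (hw'' : MemLp w'' ∞)
    (h : IsPrimitive (fun x => (w x : ℂ)) (fun x => (w' x : ℂ)))
    (h' : IsPrimitive (fun x => (w' x : ℂ)) (fun x => (w'' x : ℂ))) (t : ℝ) :
    HasDerivAt (fun t => (inner ℂ (fn (u t)) (weight w hw (weakDx (u t)))).im)
      (2 * (inner ℂ (weakDx (u t)) (weight w' hw' (weakDx (u t)))).re
        + (inner ℂ (weakDx (u t)) (weight w'' hw'' (fn (u t)))).re
        + 2 * (inner ℂ (fn (nonlinH1 ε (u t))) (weight w hw (weakDx (u t)))).re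
        + (inner ℂ (fn (nonlinH1 ε (u t))) (weight w' hw' (fn (u t)))).re) t := by
  exact hasDerivAt_of_avg (continuous_solPath (ε := ε) hu.1)
    (Φ := fun z => (inner ℂ (fn z.1) (weight w hw (weakDx z.1))).im)
    (Ψ := fun z => 2 * (inner ℂ (weakDx z.1) (weight w' hw' (weakDx z.1))).re
        + (inner ℂ (weakDx z.1) (weight w'' hw'' (fn z.1))).re
        + 2 * (inner ℂ (fn z.2) (weight w hw (weakDx z.1))).re
        + (inner ℂ (fn z.2) (weight w' hw' (fn z.1))).re)
    (by fun_prop) (by fun_prop) (fun k hk t => by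
      obtain ⟨V, D, hV, hD, hder⟩ := exists_avg_equation hu hk t
      convert! hasDerivAt_im ((hasDerivAt_fn hder).inner ℂ
        (hasDerivAt_weight hw (hasDerivAt_weakDx hder))) using 1
      set U := (avg k (solPath ε u) t).1
      set G := (avg k (solPath ε u) t).2
      have h1 := inner_weight_weakDx hw hw' h U D
      have h2 := congrArg Complex.re (inner_weight_weakDx hw hw' h V V)
      have h3 := congrArg Complex.re (inner_weight_weakDx hw' hw'' h' U V)
      rw [← hV] at *
      have s1 := im_inner_weight_symm hw' (fn U) (fn D)
      have s2 := im_inner_weight_symm hw (fn V) (fn D)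
      have s3 := re_inner_weight_symm hw (fn V) (weakDx V)
      have s4 := re_inner_weight_symm hw' (fn U) (weakDx V)
      have s5 := re_inner_weight_symm hw'' (fn U) (fn V)
      rw [h1]
      simp only [Complex.add_im, Complex.sub_im, Complex.neg_im, s1, s2]
      rw [hD]
      simp only [inner_sub_left, inner_smul_left, Complex.conj_I, Complex.sub_im, Complex.mul_im,
        Complex.neg_re, Complex.neg_im, Complex.I_re, Complex.I_im, Complex.sub_re] at *
      linarith) t

/-! ### Weights and coercivity of the virial form -/

/-- The sign function, with the value `-1` at `0` so that its square is identically `1`. -/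
def sgn (x : ℝ) : ℝ := if 0 < x then 1 else -1

lemma sgn_mul_self (x : ℝ) : sgn x * sgn x = 1 := by
  unfold sgn; split_ifs <;> norm_num

lemma abs_sgn (x : ℝ) : |sgn x| = 1 := by
  unfold sgn; split_ifs <;> simp

lemma mul_sgn (x : ℝ) : x * sgn x = |x| := by
  unfold sgn
  split_ifs with h
  · rw [abs_of_pos h, mul_one]
  · rw [abs_of_nonpos (not_lt.1 h)]; ring

lemma hasDerivAt_abs_sgn {x : ℝ} (hx : x ≠ 0) : HasDerivAt (fun x : ℝ => |x|) (sgn x) x := by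
  convert! hasDerivAt_abs hx using 1
  unfold sgn
  rcases lt_or_gt_of_ne hx with h | h
  · simp [h, h.le]
  · simp [h]

@[fun_prop] lemma measurable_sgn : Measurable sgn :=
  Measurable.ite measurableSet_Ioi measurable_const measurable_const

/-- The weight `(1 + |x|)⁻ⁿ`. -/
def decay (n : ℕ) (x : ℝ) : ℝ := ((1 + |x|)⁻¹) ^ n

lemma decay_nonneg (n : ℕ) (x : ℝ) : 0 ≤ decay n x := by unfold decay; positivity

lemma decay_le_one (n : ℕ) (x : ℝ) : decay n x ≤ 1 :=
  pow_le_one₀ (by positivity) (inv_le_one_of_one_le₀ (by linarith [abs_nonneg x]))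

lemma abs_decay_le_one (n : ℕ) (x : ℝ) : |decay n x| ≤ 1 := by
  rw [abs_of_nonneg (decay_nonneg n x)]
  exact decay_le_one n x

@[fun_prop] lemma continuous_decay (n : ℕ) : Continuous (decay n) := by
  unfold decay
  exact (Continuous.inv₀ (by fun_prop) fun x => by positivity).pow n

lemma hasDerivAt_decay (n : ℕ) {x : ℝ} (hx : x ≠ 0) :
    HasDerivAt (decay n) (-n * (sgn x * decay (n + 1) x)) x := by
  have h0 : 1 + |x| ≠ 0 := by positivity
  have h1 := (((hasDerivAt_abs_sgn hx).const_add 1).inv h0).pow n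
  convert! h1 using 1
  rcases n with _ | n
  · simp
  · simp only [decay, Nat.add_sub_cancel, Pi.inv_apply]
    rw [pow_succ (1 + |x|)⁻¹ (n + 1), pow_succ (1 + |x|)⁻¹ n]
    field_simp

lemma memLp_top_of_abs_le {w : ℝ → ℝ} (hw : Measurable w) {C : ℝ} (h : ∀ x, |w x| ≤ C) :
    MemLp w ∞ :=
  memLp_top_of_bound hw.aestronglyMeasurable C (Eventually.of_forall h)

lemma memLp_decay (n : ℕ) : MemLp (decay n) ∞ :=
  memLp_top_of_abs_le (continuous_decay n).measurable (abs_decay_le_one n)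

/-- The derivative of `decay n`. -/
def decayDeriv (n : ℕ) (x : ℝ) : ℝ := -n * (sgn x * decay (n + 1) x)

lemma abs_decayDeriv_le (n : ℕ) (x : ℝ) : |decayDeriv n x| ≤ n := by
  rw [decayDeriv, abs_mul, abs_mul, abs_sgn, abs_neg, Nat.abs_cast, one_mul]
  exact mul_le_of_le_one_right (Nat.cast_nonneg n) (abs_decay_le_one _ x)

lemma measurable_decayDeriv (n : ℕ) : Measurable (decayDeriv n) := by
  unfold decayDeriv
  fun_prop

lemma memLp_decayDeriv (n : ℕ) : MemLp (decayDeriv n) ∞ :=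
  memLp_top_of_abs_le (measurable_decayDeriv n) (abs_decayDeriv_le n)

lemma IsPrimitive.of_hasDerivAt_off_zero {F f : ℝ → ℝ} (hF : Continuous F) (hf : MemLp f ∞)
    (h : ∀ x ≠ 0, HasDerivAt F (f x) x) :
    IsPrimitive (fun x => (F x : ℂ)) (fun x => (f x : ℂ)) := by
  have hloc : LocallyIntegrable (fun x => (f x : ℂ)) :=
    (hf.ofReal (K := ℂ)).locallyIntegrable le_top
  refine ⟨hloc, fun a b => ?_⟩
  refine (integral_eq_of_hasDerivAt_off_countable (s := {0}) (fun x => (F x : ℂ)) _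
    (Set.countable_singleton 0) (by fun_prop) (fun x hx => ?_)
    (hloc.integrableOn_isCompact isCompact_uIcc).intervalIntegrable).symm
  exact (h x hx.2).ofReal_comp

lemma isPrimitive_decay (n : ℕ) :
    IsPrimitive (fun x => (decay n x : ℂ)) (fun x => (decayDeriv n x : ℂ)) :=
  .of_hasDerivAt_off_zero (continuous_decay n) (memLp_decayDeriv n) fun _ => hasDerivAt_decay n

/-- The weight `x / (1 + |x|)` of the virial functional. -/
def virialWeight (x : ℝ) : ℝ := x * decay 1 x

lemma abs_virialWeight_le (x : ℝ) : |virialWeight x| ≤ 1 := by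
  have h : 0 < 1 + |x| := by positivity
  rw [virialWeight, abs_mul, abs_of_nonneg (decay_nonneg 1 x), decay, pow_one, ← div_eq_mul_inv,
    div_le_one h]
  linarith

lemma continuous_virialWeight : Continuous virialWeight := by
  unfold virialWeight
  fun_prop

lemma memLp_virialWeight : MemLp virialWeight ∞ :=
  memLp_top_of_abs_le continuous_virialWeight.measurable abs_virialWeight_le

lemma isPrimitive_virialWeight :
    IsPrimitive (fun x => (virialWeight x : ℂ)) (fun x => (decay 2 x : ℂ)) := by
  refine .of_hasDerivAt_off_zero continuous_virialWeight (memLp_decay 2) fun x hx => ?_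
  convert! (hasDerivAt_id x).mul (hasDerivAt_decay 1 hx) using 1
  have h0 : 1 + |x| ≠ 0 := by positivity
  have h1 := mul_sgn x
  have h2 : x * (-((1 : ℕ) : ℝ) * (sgn x * decay 2 x)) = - (x * sgn x) * decay 2 x := by
    push_cast; ring
  rw [id, h2, h1]
  simp only [decay]
  field_simp
  ring

/-- The derivative of a function vanishing at `0` and at infinity has integral zero on each
half-line. -/
lemma IsPrimitive.integral_sgn_mul {F f : ℝ → ℂ} (h : IsPrimitive F f) (hF : Integrable F)
    (hf : Integrable f) (h0 : F 0 = 0) :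
    Integrable (fun x => (sgn x : ℂ) * f x) ∧ ∫ x, (sgn x : ℂ) * f x = 0 := by
  have hint : Integrable (fun x => (sgn x : ℂ) * f x) := by
    refine hf.mono ?_ (Eventually.of_forall fun x => ?_)
    · exact (Complex.measurable_ofReal.comp measurable_sgn).aestronglyMeasurable.mul
        hf.aestronglyMeasurable
    · rw [norm_mul, Complex.norm_real, Real.norm_eq_abs, abs_sgn, one_mul]
  refine ⟨hint, ?_⟩
  have e1 : ∫ x in Set.Iic 0, (sgn x : ℂ) * f x = - ∫ x in Set.Iic 0, f x := by
    rw [← integral_neg]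
    refine setIntegral_congr_fun measurableSet_Iic fun x hx => ?_
    simp [sgn, not_lt.2 (Set.mem_Iic.1 hx)]
  have e2 : ∫ x in Set.Ioi 0, (sgn x : ℂ) * f x = ∫ x in Set.Ioi 0, f x := by
    refine setIntegral_congr_fun measurableSet_Ioi fun x hx => ?_
    simp [sgn, Set.mem_Ioi.1 hx]
  rw [← intervalIntegral.integral_Iic_add_Ioi (b := 0) hint.integrableOn hint.integrableOn,
    e1, e2, h.integral_Iic hF hf, h.integral_Ioi hF hf, h0]
  simp

/-- `w F F̄` is an integrable primitive with integrable derivative. -/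
lemma isPrimitive_weight_norm_sq {w w' : ℝ → ℝ} (hw : MemLp w ∞) (hw' : MemLp w' ∞)
    (h : IsPrimitive (fun x => (w x : ℂ)) (fun x => (w' x : ℂ))) (f : H1) :
    IsPrimitive (fun x => starRingEnd ℂ (rep f x) * ((w x : ℂ) * rep f x))
      (fun x => starRingEnd ℂ (weakDx f x) * ((w x : ℂ) * fn f x)
        + (starRingEnd ℂ (fn f x) * ((w' x : ℂ) * fn f x)
          + starRingEnd ℂ (fn f x) * ((w x : ℂ) * weakDx f x))) ∧
    Integrable (fun x => starRingEnd ℂ (rep f x) * ((w x : ℂ) * rep f x)) ∧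
    Integrable (fun x => starRingEnd ℂ (weakDx f x) * ((w x : ℂ) * fn f x)
        + (starRingEnd ℂ (fn f x) * ((w' x : ℂ) * fn f x)
          + starRingEnd ℂ (fn f x) * ((w x : ℂ) * weakDx f x))) := by
  refine ⟨((isPrimitive_rep f).conj.mul (h.mul (isPrimitive_rep f))).congr_ae ?_, ?_, ?_⟩
  · filter_upwards [rep_ae f] with x hx
    rw [hx]; ring
  · refine (integrable_inner_weight hw (fn f) (fn f)).congr ?_
    filter_upwards [rep_ae f] with x hx
    rw [hx]
  · exact (integrable_inner_weight hw _ _).add ((integrable_inner_weight hw' _ _).add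
      (integrable_inner_weight hw _ _))

lemma re_integral_le {f g : ℝ → ℂ} (hf : Integrable f) (hg : Integrable g)
    (h : ∀ᵐ x, (f x).re ≤ (g x).re) : (∫ x, f x).re ≤ (∫ x, g x).re :=
  (integral_re hf).symm.trans_le ((integral_mono_ae hf.re hg.re h).trans_eq (integral_re hg))

/-- Coercivity of the virial form on functions vanishing at `0`. On each half-line, adding the
integral of the derivative of `(1 + |x|)⁻³ |f|²`, which is zero, turns the form into
`2 ‖y⁻¹ f' - sgn · y⁻² f‖² + ‖y⁻² f‖²`, where `y = 1 + |x|`. -/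
lemma virial_coercive (f : H1) (h0 : rep f 0 = 0) :
    (inner ℂ (fn f) (weight _ (memLp_decay 4) (fn f))).re ≤
      2 * (inner ℂ (weakDx f) (weight _ (memLp_decay 2) (weakDx f))).re
        + (inner ℂ (weakDx f) (weight _ (memLp_decayDeriv 2) (fn f))).re := by
  obtain ⟨hP, hi, hi'⟩ := isPrimitive_weight_norm_sq (memLp_decay 3) (memLp_decayDeriv 3)
    (isPrimitive_decay 3) f
  obtain ⟨iJ, hJ⟩ := hP.integral_sgn_mul hi hi' (by simp [h0])
  have i1 := integrable_inner_weight (memLp_decay 2) (weakDx f) (weakDx f)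
  have i2 := integrable_inner_weight (memLp_decayDeriv 2) (weakDx f) (fn f)
  have i4 := integrable_inner_weight (memLp_decay 4) (fn f) (fn f)
  have key := re_integral_le (i4.add iJ) ((i1.const_mul 2).add i2) (Eventually.of_forall fun x => by
    have hs := sgn_mul_self x
    simp only [decayDeriv, decay, Pi.add_apply]
    generalize weakDx f x = v
    generalize fn f x = z
    set d := (1 + |x|)⁻¹
    set s := sgn x
    have e : 0 ≤ 2 * d ^ 2 * ((v.re - s * d * z.re) ^ 2 + (v.im - s * d * z.im) ^ 2) := by positivity
    rw [← sub_nonneg]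
    refine e.trans_eq ?_
    simp [-Complex.ofReal_pow]
    linear_combination -(d ^ 4 * (z.re ^ 2 + z.im ^ 2)) * hs)
  rw [integral_add' i4 iJ, integral_add' (i1.const_mul 2) i2, integral_const_mul, hJ] at key
  rw [inner_weight_right, inner_weight_right, inner_weight_right]
  simpa using key

/-! ### Smallness for all times and local decay -/

lemma weakDx_mulL_ae (f g : H1) :
    weakDx (mulL f g) =ᵐ[volume] fun x => weakDx f x * rep g x + rep f x * weakDx g x :=
  ((memLp_mul_rep (Lp.memLp (weakDx f)) g).add (memLp_rep_mul f (Lp.memLp (weakDx g)))).coeFn_toLp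

lemma weakDx_conjL_ae (f : H1) :
    weakDx (conjL f) =ᵐ[volume] fun x => starRingEnd ℂ (weakDx f x) :=
  (Lp.memLp (weakDx f)).star.coeFn_toLp

/-- The nonlinearity contributes with a good sign to the virial identity, provided that the quintic
term is dominated by the cubic one. With `s = |f|²` and `Q = s/2 + ε s²/3`, subtracting the integral
of the derivative of `φ s Q`, where `φ` is the virial weight, leaves
`∫ φ' (s²/2 + 2 ε s³/3)`. -/
lemma virial_nonlin_nonneg (f : H1) (hf : ∀ x, |ε| * ‖rep f x‖ ^ 2 ≤ 3 / 4) :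
    0 ≤ 2 * (inner ℂ (fn (nonlinH1 ε f)) (weight _ memLp_virialWeight (weakDx f))).re
      + (inner ℂ (fn (nonlinH1 ε f)) (weight _ (memLp_decay 2) (fn f))).re := by
  set S : H1 := mulL f (conjL f) with hS
  set Q : H1 := (1 / 2 : ℝ) • S + (ε / 3) • mulL S S with hQ
  have ibp := inner_weight_weakDx memLp_virialWeight (memLp_decay 2) isPrimitive_virialWeight S Q
  have i1 := integrable_inner_weight memLp_virialWeight (fn (nonlinH1 ε f)) (weakDx f)
  have i2 := integrable_inner_weight (memLp_decay 2) (fn (nonlinH1 ε f)) (fn f)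
  have j1 := integrable_inner_weight memLp_virialWeight (fn S) (weakDx Q)
  have j2 := integrable_inner_weight (memLp_decay 2) (fn S) (fn Q)
  have j3 := integrable_inner_weight memLp_virialWeight (weakDx S) (fn Q)
  have key := re_integral_le (j1.add (j2.add j3)) ((i1.const_mul 2).add i2) (by
    have hQd : weakDx Q =ᵐ[volume] fun x =>
        (1 / 2 : ℝ) • weakDx S x + (ε / 3) • weakDx (mulL S S) x := by
      rw [hQ, weakDx_add, weakDx_smul, weakDx_smul]
      filter_upwards [Lp.coeFn_add ((1 / 2 : ℝ) • weakDx S) ((ε / 3) • weakDx (mulL S S)),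
        Lp.coeFn_smul (1 / 2 : ℝ) (weakDx S), Lp.coeFn_smul (ε / 3) (weakDx (mulL S S))]
        with x h1 h2 h3
      rw [h1, Pi.add_apply, h2, h3, Pi.smul_apply, Pi.smul_apply]
    filter_upwards [rep_ae f, rep_ae (nonlinH1 ε f), rep_ae S, rep_ae Q, weakDx_mulL_ae f (conjL f),
      weakDx_mulL_ae S S, weakDx_conjL_ae f, hQd] with x h1 h2 h3 h4 h5 h6 h7 h8
    have hsize := hf x
    simp only [Pi.add_apply]
    rw [← h1, ← h2, ← h3, ← h4, h8, h6, h5, h7, rep_nonlinH1, hQ]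
    simp only [rep_add, rep_smul, Pi.add_apply, Pi.smul_apply, rep_mulL, rep_conjL, hS, nonlin,
      Complex.real_smul]
    have hd := decay_nonneg 2 x
    generalize rep f x = z at *
    generalize weakDx f x = v at *
    have hn : (z.re ^ 2 + z.im ^ 2) = ‖z‖ ^ 2 := by
      rw [Complex.sq_norm, Complex.normSq_apply]; ring
    set r := ‖z‖ with hr
    have e2 : (r : ℂ) ^ 2 = ((z.re ^ 2 + z.im ^ 2 : ℝ) : ℂ) := by rw [hn]; push_cast; rfl
    have e4 : (r : ℂ) ^ 4 = (((z.re ^ 2 + z.im ^ 2) ^ 2 : ℝ) : ℂ) := by rw [hn]; push_cast; ring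
    have e4' : r ^ 4 = (z.re ^ 2 + z.im ^ 2) ^ 2 := by rw [hn]; ring
    have hpos : 0 ≤ decay 2 x * (r ^ 4 * (1 / 2 + 2 / 3 * (ε * r ^ 2))) := by
      have h := neg_abs_le (ε * r ^ 2)
      rw [abs_mul, abs_of_nonneg (sq_nonneg r)] at h
      have : 0 ≤ 1 / 2 + 2 / 3 * (ε * r ^ 2) := by linarith
      positivity
    rw [← sub_nonneg]
    refine hpos.trans_eq ?_
    rw [e4', ← hn, e2, e4]
    simp [-Complex.ofReal_pow, -Complex.ofReal_add]
    ring)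
  rw [integral_add' j1 (j2.add j3), integral_add' j2 j3, integral_add' (i1.const_mul 2) i2,
    integral_const_mul] at key
  rw [inner_weight_right, inner_weight_right, inner_weight_right] at ibp
  rw [inner_weight_right, inner_weight_right]
  refine le_trans (le_of_eq ?_) (key.trans_eq ?_)
  · rw [ibp]; simp
  · simp

lemma norm_weight_sq (f : L2) :
    ‖weight _ (memLp_decay 2) f‖ ^ 2 = (inner ℂ f (weight _ (memLp_decay 4) f)).re := by
  have h : weight _ (memLp_decay 2) (weight _ (memLp_decay 2) f) = weight _ (memLp_decay 4) f := by
    refine Lp.ext ?_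
    filter_upwards [coeFn_weight (memLp_decay 2) (weight _ (memLp_decay 2) f),
      coeFn_weight (memLp_decay 2) f, coeFn_weight (memLp_decay 4) f] with x h1 h2 h3
    rw [h1, h2, h3]
    simp only [decay]
    push_cast
    ring
  rw [← h, ← inner_weight_left, norm_sq_eq_re_inner (𝕜 := ℂ)]
  rfl

/-- Pointwise control of `f` by its weighted `L²` norm. -/
lemma decay_mul_norm_rep_sq_le (f : H1) (x : ℝ) :
    decay 2 x * ‖rep f x‖ ^ 2 ≤ 4 * (‖weight _ (memLp_decay 2) (fn f)‖ * ‖f‖) := by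
  obtain ⟨hP, hi, hi'⟩ := isPrimitive_weight_norm_sq (memLp_decay 2) (memLp_decayDeriv 2)
    (isPrimitive_decay 2) f
  have h1 := hP.norm_le hi hi' x
  set W := weight _ (memLp_decay 2) (fn f) with hW
  have k1 := integrable_norm_mul_norm W (weakDx f)
  have k2 := integrable_norm_mul_norm W (fn f)
  have h2 : ∀ᵐ x, ‖starRingEnd ℂ (weakDx f x) * ((decay 2 x : ℂ) * fn f x)
        + (starRingEnd ℂ (fn f x) * ((decayDeriv 2 x : ℂ) * fn f x)
          + starRingEnd ℂ (fn f x) * ((decay 2 x : ℂ) * weakDx f x))‖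
      ≤ 2 * (‖W x‖ * ‖weakDx f x‖) + 2 * (‖W x‖ * ‖fn f x‖) := by
    filter_upwards [coeFn_weight (memLp_decay 2) (fn f)] with x hx
    refine norm_add_le_of_le le_rfl (norm_add_le _ _) |>.trans ?_
    rw [hW, hx]
    have hd := decay_nonneg 2 x
    have h3 : |decayDeriv 2 x| ≤ 2 * decay 2 x := by
      rw [decayDeriv, abs_mul, abs_mul, abs_sgn, abs_of_nonneg (decay_nonneg 3 x)]
      have : decay 3 x = decay 2 x * decay 1 x := by simp only [decay]; ring
      have := mul_le_of_le_one_right hd (decay_le_one 1 x)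
      norm_num
      linarith
    have h4 := mul_le_mul_of_nonneg_right h3 (mul_self_nonneg ‖fn f x‖)
    simp only [norm_mul, RCLike.norm_conj, Complex.norm_real, Real.norm_eq_abs, abs_of_nonneg hd]
    linarith
  have h3 := h1.trans (integral_mono_ae hi'.norm ((k1.const_mul 2).add (k2.const_mul 2)) h2)
  rw [integral_add' (k1.const_mul 2) (k2.const_mul 2), integral_const_mul, integral_const_mul] at h3
  have h5 := integral_norm_mul_norm_le W (weakDx f)
  have h6 := integral_norm_mul_norm_le W (fn f)
  have h7 := mul_le_mul_of_nonneg_left (norm_weakDx_le f) (norm_nonneg W)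
  have h8 := mul_le_mul_of_nonneg_left (norm_fn_le f) (norm_nonneg W)
  have h9 : ‖starRingEnd ℂ (rep f x) * ((decay 2 x : ℂ) * rep f x)‖
      = decay 2 x * ‖rep f x‖ ^ 2 := by
    rw [norm_mul, norm_mul, RCLike.norm_conj, Complex.norm_real, Real.norm_eq_abs,
      abs_of_nonneg (decay_nonneg 2 x)]
    ring
  rw [h9] at h3
  linarith

lemma rep_zero_of_odd {f : H1} (h : IsOddH1 f) : rep f 0 = 0 := by
  have h1 : ∀ᵐ x : ℝ, rep f (-x) = fn f (-x) :=
    (Measure.measurePreserving_neg volume).quasiMeasurePreserving.ae (rep_ae f)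
  have h2 : (fun x => rep f (-x)) =ᵐ[volume] fun x => - rep f x := by
    filter_upwards [h, h1, rep_ae f] with x a b c
    rw [b, a, c]
  have hc := continuous_rep f
  have h3 := congrFun ((Continuous.ae_eq_iff_eq volume (by fun_prop) (by fun_prop)).1 h2) 0
  simp only [neg_zero] at h3
  exact self_eq_neg.1 h3

/-- Conservation of mass. -/
lemma norm_fn_solution (hu : IsGlobalSolution ε u) (t : ℝ) : ‖fn (u t)‖ = ‖fn (u 0)‖ := by
  have hd : ∀ t, HasDerivAt (fun t => ‖fn (u t)‖ ^ 2) 0 t := by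
    intro t
    have h := hasDerivAt_localMass hu (memLp_top_const 1) (memLp_top_const 0)
      (by simpa using IsPrimitive.const 1) t
    simp only [weight_one, weight_zero, inner_zero_right, Complex.zero_im, mul_zero] at h
    convert! h using 2 with s
    exact norm_sq_eq_re_inner (𝕜 := ℂ) _
  have := is_const_of_deriv_eq_zero (fun t => (hd t).differentiableAt) (fun t => (hd t).deriv) t 0
  exact (pow_left_inj₀ (norm_nonneg _) (norm_nonneg _) two_ne_zero).1 this

lemma energy_solution (hu : IsGlobalSolution ε u) (t : ℝ) : energy ε (u t) = energy ε (u 0) :=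
  is_const_of_deriv_eq_zero (fun t => (hasDerivAt_energy_solution hu t).differentiableAt)
    (fun t => (hasDerivAt_energy_solution hu t).deriv) t 0

lemma norm_fn_mulL_le {f : H1} {C : ℝ} (hC : ∀ x, ‖rep f x‖ ≤ C) (g : H1) :
    ‖fn (mulL f g)‖ ≤ C * ‖fn g‖ := by
  refine Lp.norm_le_mul_norm_of_ae_le_mul ?_
  filter_upwards [rep_ae (mulL f g), rep_ae g] with x h1 h2
  rw [← h1, ← h2, rep_mulL, norm_mul]
  exact mul_le_mul_of_nonneg_right (hC x) (norm_nonneg _)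

lemma norm_fn_cube_sq_le {f : H1} {C : ℝ} (hC : ∀ x, ‖rep f x‖ ^ 2 ≤ C) :
    ‖fn (mulL (mulL f f) f)‖ ^ 2 ≤ C ^ 2 * ‖fn f‖ ^ 2 := by
  rw [← mul_pow]
  refine pow_le_pow_left₀ (norm_nonneg _) (norm_fn_mulL_le (fun x => ?_) f) 2
  rw [rep_mulL, norm_mul, ← sq]
  exact hC x

/-- Coercivity of the energy at small mass, by the Gagliardo-Nirenberg inequality
`∫ |f|⁶ ≤ 4 ‖f‖⁴ ‖f'‖²`. -/
lemma norm_weakDx_sq_le_energy {f : H1} (h : |ε| * ‖fn f‖ ^ 4 ≤ 3 / 8) :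
    ‖weakDx f‖ ^ 2 ≤ 4 * energy ε f := by
  have h1 := norm_fn_cube_sq_le (norm_rep_sq_le_mul f)
  have h2 : -(|ε| * ‖fn (mulL (mulL f f) f)‖ ^ 2) ≤ ε * ‖fn (mulL (mulL f f) f)‖ ^ 2 := by
    have := mul_le_mul_of_nonneg_right (neg_abs_le ε) (sq_nonneg ‖fn (mulL (mulL f f) f)‖)
    linarith
  have h3 := mul_le_mul_of_nonneg_left h1 (abs_nonneg ε)
  have h4 := mul_le_mul_of_nonneg_right h (sq_nonneg ‖weakDx f‖)
  have h5 := sq_nonneg ‖fn (mulL f f)‖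
  unfold energy
  nlinarith

lemma energy_le (f : H1) (h1 : ‖f‖ ≤ 1) (h2 : |ε| * ‖f‖ ^ 2 ≤ 1) : energy ε f ≤ ‖f‖ ^ 2 := by
  have hd : ‖weakDx f‖ ^ 2 ≤ ‖f‖ ^ 2 := by gcongr; exact norm_weakDx_le f
  have hf : ‖fn f‖ ^ 2 ≤ ‖f‖ ^ 2 := by gcongr; exact norm_fn_le f
  have hn : ‖f‖ ^ 2 ≤ 1 := pow_le_one₀ (norm_nonneg _) h1
  have a1 : ‖fn (mulL f f)‖ ^ 2 ≤ ‖f‖ ^ 2 := by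
    refine pow_le_pow_left₀ (norm_nonneg _) ?_ 2
    have := norm_fn_mulL_le (norm_rep_le f) f
    have h3 := norm_fn_le f
    nlinarith [norm_nonneg f, norm_nonneg (fn f)]
  have a2 : ‖fn (mulL (mulL f f) f)‖ ^ 2 ≤ (‖f‖ ^ 2) ^ 2 * ‖fn f‖ ^ 2 :=
    norm_fn_cube_sq_le fun x => pow_le_pow_left₀ (norm_nonneg _) (norm_rep_le f x) 2
  have a3 : ε * ‖fn (mulL (mulL f f) f)‖ ^ 2 ≤ ‖f‖ ^ 2 := by
    calc ε * ‖fn (mulL (mulL f f) f)‖ ^ 2 ≤ |ε| * ((‖f‖ ^ 2) ^ 2 * ‖fn f‖ ^ 2) :=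
          mul_le_mul (le_abs_self ε) a2 (sq_nonneg _) (abs_nonneg _)
      _ = (|ε| * ‖f‖ ^ 2) * (‖f‖ ^ 2 * ‖fn f‖ ^ 2) := by ring
      _ ≤ 1 * (1 * ‖f‖ ^ 2) := by gcongr
      _ = ‖f‖ ^ 2 := by ring
  unfold energy
  nlinarith [sq_nonneg ‖f‖]

/-- A small solution stays small in `H¹`, by conservation of mass and energy. -/
lemma norm_solution_sq_le (hu : IsGlobalSolution ε u) {δ : ℝ} (h0 : ‖u 0‖ ≤ δ) (h1 : δ ≤ 1)
    (h2 : |ε| * δ ^ 2 ≤ 1 / 12) (t : ℝ) : ‖u t‖ ^ 2 ≤ 5 * δ ^ 2 := by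
  have hsq : ‖u 0‖ ^ 2 ≤ δ ^ 2 := pow_le_pow_left₀ (norm_nonneg _) h0 2
  have hε : |ε| * ‖u 0‖ ^ 2 ≤ 1 / 12 :=
    (mul_le_mul_of_nonneg_left hsq (abs_nonneg ε)).trans h2
  have hM : ‖fn (u t)‖ ^ 2 ≤ ‖u 0‖ ^ 2 := by
    rw [norm_fn_solution hu]
    exact pow_le_pow_left₀ (norm_nonneg _) (norm_fn_le _) 2
  have hn : ‖u 0‖ ^ 2 ≤ 1 := pow_le_one₀ (norm_nonneg _) (h0.trans h1)
  have hM4 : |ε| * ‖fn (u t)‖ ^ 4 ≤ 3 / 8 := by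
    calc |ε| * ‖fn (u t)‖ ^ 4 = |ε| * (‖fn (u t)‖ ^ 2 * ‖fn (u t)‖ ^ 2) := by ring
      _ ≤ |ε| * (‖u 0‖ ^ 2 * 1) := by gcongr; exact hM.trans hn
      _ ≤ 3 / 8 := by linarith
  have h3 := norm_weakDx_sq_le_energy hM4
  rw [energy_solution hu] at h3
  have h4 := energy_le (ε := ε) (u 0) (h0.trans h1) (by linarith)
  rw [norm_sq_eq]
  linarith

/-- If `P` is bounded above and increases at least at the rate `m ≥ 0`, and `m` is Lipschitz, then
`m` tends to zero: otherwise `P` would increase by a fixed amount infinitely often. -/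
lemma tendsto_zero_of_le_deriv {P P' m : ℝ → ℝ} (hP : ∀ t, HasDerivAt P (P' t) t)
    (hm : ∀ t, m t ≤ P' t) (hm0 : ∀ t, 0 ≤ m t) {B : ℝ} (hB : ∀ t, P t ≤ B) {L : ℝ} (hL : 0 < L)
    (hlip : ∀ s t, |m t - m s| ≤ L * |t - s|) : Tendsto m atTop (𝓝 0) := by
  have hmono : Monotone P := monotone_of_deriv_nonneg (fun t => (hP t).differentiableAt)
    fun t => by rw [(hP t).deriv]; exact (hm0 t).trans (hm t)
  have hlim := tendsto_atTop_ciSup hmono ⟨B, by rintro _ ⟨t, rfl⟩; exact hB t⟩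
  set l := ⨆ t, P t
  have hle : ∀ t, P t ≤ l := fun t => le_ciSup ⟨B, by rintro _ ⟨t, rfl⟩; exact hB t⟩ t
  rw [Metric.tendsto_atTop]
  intro η hη
  obtain ⟨T, hT⟩ := (Metric.tendsto_atTop.1 hlim) (η / 2 * (η / (2 * L))) (by positivity)
  refine ⟨T, fun t ht => ?_⟩
  rw [Real.dist_eq, sub_zero, abs_of_nonneg (hm0 t)]
  by_contra! hcon
  set τ := η / (2 * L) with hτ
  have hτ0 : 0 < τ := by positivity
  -- On `[t, t + τ]` the Lipschitz bound keeps `m` above `η / 2`.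
  have hinc : η / 2 * ((t + τ) - t) ≤ P (t + τ) - P t := by
    refine (convex_Icc t (t + τ)).mul_sub_le_image_sub_of_le_deriv
      (fun s _ => (hP s).continuousAt.continuousWithinAt)
      (fun s _ => (hP s).differentiableAt.differentiableWithinAt) (fun s hs => ?_)
      t (by simp [hτ0.le]) (t + τ) (by simp [hτ0.le]) (by linarith)
    rw [interior_Icc] at hs
    rw [(hP s).deriv]
    refine le_trans ?_ (hm s)
    have h1 := hlip t s
    rw [abs_of_pos (sub_pos.2 hs.1)] at h1
    have h2 : L * (s - t) ≤ L * τ := mul_le_mul_of_nonneg_left (by linarith [hs.2]) hL.le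
    have h3 : L * τ = η / 2 := by rw [hτ]; field_simp
    linarith [neg_abs_le (m s - m t)]
  have h1 := hT t ht
  rw [Real.dist_eq, abs_lt] at h1
  have h2 := hle (t + τ)
  have h3 : (t + τ) - t = τ := by ring
  rw [h3] at hinc
  linarith [h1.1]

/-- Local energy decay: the weighted `L²` norm of a small odd solution tends to zero. -/
lemma tendsto_norm_weight (hu : IsGlobalSolution ε u) (hodd : ∀ t, IsOddH1 (u t))
    (hb : ∀ t, ‖u t‖ ≤ 3) (hε : ∀ t, |ε| * ‖u t‖ ^ 2 ≤ 3 / 4) :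
    Tendsto (fun t => ‖weight _ (memLp_decay 2) (fn (u t))‖) atTop (𝓝 0) := by
  have hinner : ∀ {w : ℝ → ℝ} (hw : MemLp w ∞) {C : ℝ}, (∀ x, |w x| ≤ C) → 0 ≤ C → ∀ t,
      ‖inner ℂ (fn (u t)) (weight w hw (weakDx (u t)))‖ ≤ C * 9 := by
    intro w hw C hC hC0 t
    have h2 : ‖fn (u t)‖ ≤ 3 := (norm_fn_le _).trans (hb t)
    have h3 : ‖weakDx (u t)‖ ≤ 3 := (norm_weakDx_le _).trans (hb t)
    calc _ ≤ ‖fn (u t)‖ * ‖weight w hw (weakDx (u t))‖ := norm_inner_le_norm _ _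
      _ ≤ 3 * (C * 3) := by
        gcongr
        exact (norm_weight_le hw hC _).trans (by gcongr)
      _ = C * 9 := by ring
  have hm : Tendsto (fun t => (inner ℂ (fn (u t)) (weight _ (memLp_decay 4) (fn (u t)))).re) atTop
      (𝓝 0) := by
    have hlip := hasDerivAt_localMass hu (memLp_decay 4) (memLp_decayDeriv 4) (isPrimitive_decay 4)
    refine tendsto_zero_of_le_deriv (B := 1 * 9) (L := 2 * (4 * 9))
      (hasDerivAt_virial hu memLp_virialWeight (memLp_decay 2) (memLp_decayDeriv 2)
        isPrimitive_virialWeight (isPrimitive_decay 2)) (fun t => ?_) (fun t => ?_) (fun t => ?_)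
      (by norm_num) (fun s t => ?_)
    · have h1 := virial_coercive (u t) (rep_zero_of_odd (hodd t))
      have h2 := virial_nonlin_nonneg (ε := ε) (u t) fun x =>
        (mul_le_mul_of_nonneg_left (pow_le_pow_left₀ (norm_nonneg _) (norm_rep_le _ x) 2)
          (abs_nonneg ε)).trans (hε t)
      linarith
    · rw [← norm_weight_sq]
      positivity
    · exact (le_abs_self _).trans ((Complex.abs_im_le_norm _).trans
        (hinner _ abs_virialWeight_le zero_le_one t))
    · refine convex_univ.norm_image_sub_le_of_norm_hasDerivWithin_le
        (fun t _ => (hlip t).hasDerivWithinAt) (fun t _ => ?_) (Set.mem_univ s) (Set.mem_univ t)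
      rw [norm_mul, Real.norm_eq_abs, Real.norm_eq_abs, abs_two]
      have h1 := (Complex.abs_im_le_norm _).trans
        (hinner (memLp_decayDeriv 4) (abs_decayDeriv_le 4) (Nat.cast_nonneg 4) t)
      push_cast at h1
      linarith
  have h := hm.sqrt
  simp only [← norm_weight_sq, Real.sqrt_sq (norm_nonneg _), Real.sqrt_zero] at h
  exact h

end QuinticNLS

end

theorem corollary1p2 (ε : ℝ) (hε : ε ≠ 0) :
    ∃ δ : ℝ, 0 < δ ∧
      ∀ u : ℝ → QuinticNLS.H1, QuinticNLS.IsGlobalSolution ε u →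
        (∀ t : ℝ, QuinticNLS.IsOddH1 (u t)) → ‖u 0‖ ≤ δ →
          ∀ J : Set ℝ, J.OrdConnected → Bornology.IsBounded J →
            Tendsto
              (fun t : ℝ =>
                eLpNorm (QuinticNLS.fn (u t)) 2 (volume.restrict J) + eLpNorm (QuinticNLS.fn (u t)) ∞ (volume.restrict J))
              atTop (𝓝 0) := by
  have hε0 := abs_nonneg ε
  -- Any `δ ≤ 1` with `|ε| δ² ≤ 1/12` works.
  refine ⟨(4 * (1 + |ε|))⁻¹, by positivity, fun u hu hodd h0 J hJo hJ => ?_⟩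
  have hδ1 : (4 * (1 + |ε|))⁻¹ ≤ 1 := inv_le_one_of_one_le₀ (by linarith)
  have hδ2 : |ε| * (4 * (1 + |ε|))⁻¹ ^ 2 ≤ 1 / 12 := by
    rw [inv_pow, ← div_eq_mul_inv, div_le_div_iff₀ (by positivity) (by norm_num)]
    nlinarith
  have hb := QuinticNLS.norm_solution_sq_le hu h0 hδ1 hδ2
  set δ := (4 * (1 + |ε|))⁻¹
  have hδ0 : 0 < δ := by positivity
  have hb3 : ∀ t, ‖u t‖ ≤ 3 := fun t =>
    abs_le_of_sq_le_sq' ((hb t).trans (by nlinarith)) (by norm_num) |>.2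
  have hW := QuinticNLS.tendsto_norm_weight hu hodd hb3 fun t =>
    (mul_le_mul_of_nonneg_left (hb t) hε0).trans (by linarith)
  obtain ⟨R, hR⟩ := hJ.subset_closedBall 0
  set C : ℝ → ℝ := fun t => Real.sqrt ((1 + R) ^ 2 *
    (12 * ‖QuinticNLS.weight _ (QuinticNLS.memLp_decay 2) (QuinticNLS.fn (u t))‖)) with hC
  have hbound : ∀ t, ∀ᵐ x ∂(volume.restrict J), ‖QuinticNLS.fn (u t) x‖ ≤ C t := by
    intro t
    filter_upwards [ae_restrict_of_ae (QuinticNLS.rep_ae (u t)), ae_restrict_mem hJo.measurableSet]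
      with x hx hxJ
    rw [← hx, hC]
    refine Real.le_sqrt_of_sq_le ?_
    have hxR : |x| ≤ R := by simpa using hR hxJ
    have h1 := QuinticNLS.decay_mul_norm_rep_sq_le (u t) x
    have h2 : (1 + |x|) ^ 2 * QuinticNLS.decay 2 x = 1 := by
      have : 1 + |x| ≠ 0 := by positivity
      rw [QuinticNLS.decay]
      field_simp
    set W := ‖QuinticNLS.weight _ (QuinticNLS.memLp_decay 2) (QuinticNLS.fn (u t))‖
    calc ‖QuinticNLS.rep (u t) x‖ ^ 2
        = (1 + |x|) ^ 2 * (QuinticNLS.decay 2 x * ‖QuinticNLS.rep (u t) x‖ ^ 2) := by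
          rw [← mul_assoc, h2, one_mul]
      _ ≤ (1 + R) ^ 2 * (4 * (W * 3)) := by
          have h3 : W * ‖u t‖ ≤ W * 3 := mul_le_mul_of_nonneg_left (hb3 t) (norm_nonneg _)
          refine mul_le_mul ?_ (by linarith) (by unfold QuinticNLS.decay; positivity)
            (by positivity)
          gcongr
      _ = (1 + R) ^ 2 * (12 * W) := by ring
  have hCt : Tendsto (fun t => ENNReal.ofReal (C t)) atTop (𝓝 0) := by
    have h1 := ((hW.const_mul 12).const_mul ((1 + R) ^ 2)).sqrt
    simp only [mul_zero, Real.sqrt_zero] at h1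
    have h2 := ENNReal.tendsto_ofReal h1
    rwa [ENNReal.ofReal_zero] at h2
  have hJfin : volume J ≠ ⊤ := hJ.measure_lt_top.ne
  have hK : ∀ p : ℝ≥0∞, Tendsto (fun t => (volume.restrict J) Set.univ ^ p.toReal⁻¹
      * ENNReal.ofReal (C t)) atTop (𝓝 0) := by
    intro p
    have hfin : (volume.restrict J) Set.univ ^ p.toReal⁻¹ ≠ ⊤ := by
      rw [Measure.restrict_apply_univ]
      exact ENNReal.rpow_ne_top_of_nonneg (by positivity) hJfin
    simpa using ENNReal.Tendsto.const_mul hCt (Or.inr hfin)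
  have hsum := (hK 2).add (hK ⊤)
  rw [add_zero] at hsum
  refine tendsto_of_tendsto_of_tendsto_of_le_of_le tendsto_const_nhds hsum (fun _ => zero_le)
    (fun t => ?_)
  exact add_le_add (eLpNorm_le_of_ae_bound (hbound t)) (eLpNorm_le_of_ae_bound (hbound t))
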